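/- Theorem (metric completion of $M_+(n,m)$). Let $n>m$ be natural numbers, let $M(n,m)$ be the space of real $n\times m$ matrices, and let $M_+(n,m)=\{a\in M(n,m):\operatorname{rank}(a)=m\}$. Equip $M_+(n,m)$ with the Riemannian metric $$\langle u,v\rangle_a=\operatorname{tr}\bigl(u(a^Ta)^{-1}v^T\bigr)\sqrt{\det(a^Ta)},\qquad u,v\in T_aM_+(n,m)=M(n,m),$$ with norm $\|u\|_a=\sqrt{\langle u,u\rangle_a}$, and with its geodesic distance $$\operatorname{dist}(a_0,a_1)=\inf\Bigl\{\int_0^1\|\gamma'(t)\|_{\gamma(t)}\,dt \;\Big|\; \gamma\colon[0,1]\to M_+(n,m)\text{ continuous and piecewise } C^1,\ \gamma(0)=a_0,\ \gamma(1)=a_1\Bigr\}.$$ Let $\sim$ be the equivalence relation on $M(n,m)$ given by $a\sim b$ if and only if $a=b$, or $\operatorname{rank}(a)<m$ and $\operatorname{rank}(b)<m$; thus all matrices of rank less than $m$ are identified to a single point and nothing else is identified. Then $M(n,m)/{\sim}$ is the metric completion of $(M_+(n,m),\operatorname{dist})$. That is, there is a metric $d$ on the set $M(n,m)/{\sim}$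 such that $(M(n,m)/{\sim},d)$ is a complete metric space, $d([a],[b])=\operatorname{dist}(a,b)$ for all $a,b\in M_+(n,m)$, and the image of $M_+(n,m)$ under $a\mapsto[a]$ is dense. Moreover, the canonical projection $M(n,m)\to (M(n,m)/{\sim},d)$ is continuous, where $M(n,m)=\mathbb R^{n\times m}$ carries its usual topology (so the added point is the limit of every sequence in $M_+(n,m)$ that converges in $M(n,m)$ to a matrix of rank less than $m$). -/

import Mathlib

noncomputable section

open Set MeasureTheory
open scoped ENNReal

/-- The space `M_+(n,m)` of real `n × m` matrices of full rank `m` (for `m ≤ n`). -/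
abbrev FullRankMatrix (n m : ℕ) : Type :=
  {a : Matrix (Fin n) (Fin m) ℝ // a.rank = m}

/-- The Riemannian metric `⟨u, v⟩_a = tr (u (aᵀ a)⁻¹ vᵀ) √(det (aᵀ a))` at the foot point `a`
(of interest for `a` of full rank `m`, where `aᵀ a` is invertible). -/
def matrixMetric {n m : ℕ} (a u v : Matrix (Fin n) (Fin m) ℝ) : ℝ :=
  (u * (a.transpose * a)⁻¹ * v.transpose).trace * Real.sqrt (a.transpose * a).det

/-- The norm `‖u‖_a = √⟨u, u⟩_a` induced by the Riemannian metric. -/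
def matrixMetricNorm {n m : ℕ} (a u : Matrix (Fin n) (Fin m) ℝ) : ℝ :=
  Real.sqrt (matrixMetric a u u)

/-- The velocity of a curve of matrices, computed entry by entry. -/
def curveVelocity {n m : ℕ} (γ : ℝ → Matrix (Fin n) (Fin m) ℝ) (t : ℝ) :
    Matrix (Fin n) (Fin m) ℝ :=
  Matrix.of fun i j => deriv (fun s => γ s i j) t

/-- The length `∫₀¹ ‖γ'(t)‖_{γ(t)} dt` of a curve, as an extended non-negative number. -/
def curveLength {n m : ℕ} (γ : ℝ → Matrix (Fin n) (Fin m) ℝ) : ℝ≥0∞ :=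
  ∫⁻ t in Icc (0 : ℝ) 1, ENNReal.ofReal (matrixMetricNorm (γ t) (curveVelocity γ t))

/-- `γ` restricts to a piecewise continuously differentiable curve `[0,1] → M_+(n,m)` from `a` to
`b`: it is continuous on `[0,1]`, takes full-rank values there, and there is a finite set `S` of
break points such that all entries of `γ` are `C¹` on every closed subinterval of `[0,1]` with no
break point in its interior. -/
structure IsAdmissibleCurve {n m : ℕ} (a b : FullRankMatrix n m)
    (γ : ℝ → Matrix (Fin n) (Fin m) ℝ) : Prop where
  continuousOn : ContinuousOn γ (Icc 0 1)
  rank_eq : ∀ t ∈ Icc (0 : ℝ) 1, (γ t).rank = m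
  piecewise_contDiffOn : ∃ S : Finset ℝ, ∀ c d : ℝ, 0 ≤ c → d ≤ 1 → (∀ s ∈ S, s ∉ Ioo c d) →
    ∀ i j, ContDiffOn ℝ 1 (fun t => γ t i j) (Icc c d)
  source : γ 0 = a
  target : γ 1 = b

/-- The geodesic distance on `M_+(n,m)`: the infimum of the lengths of the piecewise `C¹` curves
in `M_+(n,m)` between two points (it is `∞` if there is no such curve). -/
def geodesicEDist {n m : ℕ} (a b : FullRankMatrix n m) : ℝ≥0∞ :=
  ⨅ (γ : ℝ → Matrix (Fin n) (Fin m) ℝ) (_ : IsAdmissibleCurve a b γ), curveLength γ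

/-- The equivalence relation on all `n × m` matrices that identifies any two matrices of rank less
than `m`, and nothing else. -/
def rankDeficientSetoid (n m : ℕ) : Setoid (Matrix (Fin n) (Fin m) ℝ) where
  r a b := a = b ∨ (a.rank < m ∧ b.rank < m)
  iseqv :=
    { refl := fun _ => Or.inl rfl
      symm := by
        rintro a b (h | h)
        · exact Or.inl h.symm
        · exact Or.inr h.symm
      trans := by
        rintro a b c (rfl | h) (rfl | h')
        · exact Or.inl rfl
        · exact Or.inr h'
        · exact Or.inr h
        · exact Or.inr ⟨h.1, h'.2⟩ }

/-- The quotient set `M(n,m)/∼`. It carries no topology of its own here. -/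
def MatrixQuotient (n m : ℕ) : Type :=
  Quotient (rankDeficientSetoid n m)

/-- The canonical projection `M(n,m) → M(n,m)/∼`. -/
def matrixQuotientMk {n m : ℕ} (a : Matrix (Fin n) (Fin m) ℝ) : MatrixQuotient n m :=
  Quotient.mk (rankDeficientSetoid n m) a

/-- The metric space `Y`, with the map `ι : X → Y`, is the metric completion of the set `X` with
the distance `d`: `Y` is complete, `ι` preserves distances and `ι` has dense image. -/
structure IsMetricCompletion {X Y : Type*} [MetricSpace Y] (d : X → X → ℝ≥0∞) (ι : X → Y) :
    Prop where
  edist_eq : ∀ x y, edist (ι x) (ι y) = d x y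
  denseRange : DenseRange ι
  complete : CompleteSpace Y

end

noncomputable section

open Set MeasureTheory Filter Topology
open scoped ENNReal Matrix

/-! ### Gram determinant, Frobenius norm and the pointwise form of the metric. -/

section LinearAlgebra

variable {n m : ℕ}

/-! The metric is governed by `gramRoot a`, the fourth root of det(aᵀa), which is positive exactly
at full rank. Cauchy–Schwarz for the form tr(u(aᵀa)⁻¹vᵀ), applied to u and a, bounds the derivative
of `gramRoot` by √m/2 times the Riemannian norm. Hence `apexDist`, which is 2/√m times `gramRoot`,
is 1-Lipschitz for the geodesic distance (`abs_apexDist_sub_le`). Conversely the radial curve from a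
towards 0 has length at most `apexDist a`, so `apexDist` is the right candidate for the distance to
the added point.

All rank-deficient matrices merge into one point because scaling by r multiplies lengths by √(r^m).
To pass from a to b, shrink both radially and join them there by a scaled copy of a fixed curve; its
length tends to 0, so dist(a,b) ≤ `apexDist a` + `apexDist b` (`geodesicEDist_le_apexDist_add`). The
fixed curve exists because m < n makes the full-rank matrices connected (`geodesicEDist_lt_top`).
The Lipschitz bound and the detour bound together give the triangle inequality for the extended
distance.

Away from the added point the distance controls the Euclidean one: where `gramRoot` ≥ c, short
curves stay Frobenius-bounded by a Gronwall argument on the logarithm of the squared norm, and then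
the entries move by at most a constant times the length (`bounds_of_geodesicEDist_lt`). This
separates points and gives completeness: along a Cauchy sequence `apexDist` converges; if the limit
is 0 the sequence tends to the added point, and otherwise it converges entrywise to a limit whose
class is the limit in the quotient. -/

theorem det_gram_nonneg (a : Matrix (Fin n) (Fin m) ℝ) : 0 ≤ (aᵀ * a).det := by
  have h := Matrix.posSemidef_conjTranspose_mul_self a
  rw [Matrix.conjTranspose_eq_transpose_of_trivial] at h
  exact h.det_nonneg

theorem rank_eq_width_iff (a : Matrix (Fin n) (Fin m) ℝ) :
    a.rank = m ↔ 0 < (aᵀ * a).det := by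
  rw [← Matrix.rank_transpose_mul_self]
  constructor
  · intro h
    refine lt_of_le_of_ne (det_gram_nonneg a) (Ne.symm fun h0 => ?_)
    obtain ⟨v, hv, hv0⟩ := Matrix.exists_mulVec_eq_zero_iff.mpr h0
    have hk := LinearMap.finrank_range_add_finrank_ker (aᵀ * a).mulVecLin
    have h1 : Module.finrank ℝ (LinearMap.range (aᵀ * a).mulVecLin) = m := h
    rw [h1, Module.finrank_fin_fun] at hk
    have : LinearMap.ker (aᵀ * a).mulVecLin = ⊥ := Submodule.finrank_eq_zero.mp (by omega)
    exact hv ((LinearMap.ker_eq_bot'.mp this) v hv0)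
  · intro h
    have := Matrix.rank_of_isUnit (aᵀ * a) ((Matrix.isUnit_iff_isUnit_det _).mpr h.ne'.isUnit)
    simpa using this

theorem rank_lt_width_iff (a : Matrix (Fin n) (Fin m) ℝ) :
    a.rank < m ↔ (aᵀ * a).det = 0 := by
  have h1 : a.rank ≤ m := a.rank_le_width
  have h2 := rank_eq_width_iff a
  have h3 := det_gram_nonneg a
  constructor
  · intro h
    by_contra h0
    exact h.ne (h2.mpr (lt_of_le_of_ne h3 (Ne.symm h0)))
  · intro h
    refine lt_of_le_of_ne h1 fun h' => ?_
    exact (h2.mp h').ne' h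

theorem rank_eq_width_of_mulVec_ne_zero {a : Matrix (Fin n) (Fin m) ℝ}
    (h : ∀ v, a *ᵥ v = 0 → v = 0) : a.rank = m := by
  rw [rank_eq_width_iff]
  refine lt_of_le_of_ne (det_gram_nonneg a) (Ne.symm fun h0 => ?_)
  obtain ⟨v, hv, hv0⟩ := Matrix.exists_mulVec_eq_zero_iff.mpr h0
  refine hv (h v ?_)
  rw [← Matrix.mulVec_mulVec] at hv0
  have h2 : (a *ᵥ v) ⬝ᵥ (a *ᵥ v) = 0 := by
    rw [Matrix.dotProduct_mulVec, ← Matrix.mulVec_transpose, hv0, zero_dotProduct]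
  exact dotProduct_self_eq_zero.mp h2

theorem mulVec_eq_zero_of_rank_eq {a : Matrix (Fin n) (Fin m) ℝ} (h : a.rank = m)
    {v : Fin m → ℝ} (hv : a *ᵥ v = 0) : v = 0 := by
  by_contra h0
  refine ((rank_eq_width_iff a).mp h).ne' (Matrix.exists_mulVec_eq_zero_iff.mp ⟨v, h0, ?_⟩)
  rw [← Matrix.mulVec_mulVec, hv, Matrix.mulVec_zero]

/-- The square of the Frobenius norm. -/
def frobeniusSq {k l : ℕ} (a : Matrix (Fin k) (Fin l) ℝ) : ℝ := ∑ i, ∑ j, a i j ^ 2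

theorem frobeniusSq_nonneg {k l : ℕ} (a : Matrix (Fin k) (Fin l) ℝ) : 0 ≤ frobeniusSq a := by
  unfold frobeniusSq; positivity

theorem sq_apply_le_frobeniusSq {k l : ℕ} (a : Matrix (Fin k) (Fin l) ℝ) (i : Fin k) (j : Fin l) :
    a i j ^ 2 ≤ frobeniusSq a := by
  calc a i j ^ 2 ≤ ∑ j, a i j ^ 2 :=
        Finset.single_le_sum (f := fun j => a i j ^ 2) (fun _ _ => sq_nonneg _) (Finset.mem_univ j)
    _ ≤ _ := Finset.single_le_sum (f := fun i => ∑ j, a i j ^ 2)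
        (fun _ _ => Finset.sum_nonneg fun _ _ => sq_nonneg _) (Finset.mem_univ i)

theorem trace_mul_transpose_self {k l : ℕ} (a : Matrix (Fin k) (Fin l) ℝ) :
    (a * aᵀ).trace = frobeniusSq a := by
  simp [Matrix.trace, Matrix.mul_apply, frobeniusSq, sq]

theorem frobeniusSq_mul_le {k l r : ℕ} (p : Matrix (Fin k) (Fin l) ℝ)
    (a : Matrix (Fin l) (Fin r) ℝ) :
    frobeniusSq (p * a) ≤ frobeniusSq p * frobeniusSq a := by
  have h : ∀ i j, (p * a) i j ^ 2 ≤ (∑ q, p i q ^ 2) * ∑ q, a q j ^ 2 := fun i j => by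
    rw [Matrix.mul_apply]
    exact Finset.sum_mul_sq_le_sq_mul_sq _ _ _
  calc frobeniusSq (p * a) ≤ ∑ i, ∑ j, (∑ q, p i q ^ 2) * ∑ q, a q j ^ 2 :=
        Finset.sum_le_sum fun i _ => Finset.sum_le_sum fun j _ => h i j
    _ = frobeniusSq p * frobeniusSq a := by
        rw [frobeniusSq, frobeniusSq, Finset.sum_mul]
        refine Finset.sum_congr rfl fun i _ => ?_
        rw [← Finset.mul_sum, Finset.sum_comm]

theorem abs_sum_mul_le_sqrt_frobeniusSq {k l : ℕ} (a b : Matrix (Fin k) (Fin l) ℝ) :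
    |∑ i, ∑ j, a i j * b i j| ≤ √(frobeniusSq a) * √(frobeniusSq b) := by
  rw [← Real.sqrt_mul (frobeniusSq_nonneg a)]
  refine Real.abs_le_sqrt ?_
  simp only [frobeniusSq, ← Fintype.sum_prod_type']
  exact Finset.sum_mul_sq_le_sq_mul_sq _ _ _

theorem frobeniusSq_pos {a : Matrix (Fin n) (Fin m) ℝ} (hm : 0 < m) (h : a.rank = m) :
    0 < frobeniusSq a := by
  refine lt_of_le_of_ne (frobeniusSq_nonneg a) fun h0 => ?_
  have : a = 0 := by
    ext i j
    have := sq_apply_le_frobeniusSq a i j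
    rw [← h0] at this
    simpa using le_antisymm this (sq_nonneg _)
  rw [this, Matrix.rank_zero] at h
  omega

/-- The fourth root of the Gram determinant `det (aᵀ a)`. -/
def gramRoot (a : Matrix (Fin n) (Fin m) ℝ) : ℝ := √√(aᵀ * a).det

theorem gramRoot_nonneg (a : Matrix (Fin n) (Fin m) ℝ) : 0 ≤ gramRoot a := Real.sqrt_nonneg _

theorem rank_eq_iff_gramRoot_pos (a : Matrix (Fin n) (Fin m) ℝ) :
    a.rank = m ↔ 0 < gramRoot a := by
  rw [rank_eq_width_iff, gramRoot, Real.sqrt_pos, Real.sqrt_pos]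

theorem rank_lt_iff_gramRoot_eq_zero (a : Matrix (Fin n) (Fin m) ℝ) :
    a.rank < m ↔ gramRoot a = 0 := by
  rw [rank_lt_width_iff, gramRoot, Real.sqrt_eq_zero (Real.sqrt_nonneg _),
    Real.sqrt_eq_zero (det_gram_nonneg a)]

theorem continuous_gramRoot :
    Continuous (gramRoot : Matrix (Fin n) (Fin m) ℝ → ℝ) := by
  unfold gramRoot
  fun_prop

theorem gramRoot_smul {r : ℝ} (hr : 0 ≤ r) (a : Matrix (Fin n) (Fin m) ℝ) :
    gramRoot (r • a) = √(r ^ m) * gramRoot a := by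
  have : ((r • a)ᵀ * (r • a)).det = (r ^ m) ^ 2 * (aᵀ * a).det := by
    rw [Matrix.transpose_smul, Matrix.smul_mul, Matrix.mul_smul, smul_smul, Matrix.det_smul,
      Fintype.card_fin]
    ring
  rw [gramRoot, this, Real.sqrt_mul (by positivity), Real.sqrt_sq (by positivity),
    Real.sqrt_mul (by positivity), gramRoot]

/-- The quadratic form `tr (u (aᵀ a)⁻¹ uᵀ)`. -/
def gramForm (a u : Matrix (Fin n) (Fin m) ℝ) : ℝ := (u * (aᵀ * a)⁻¹ * uᵀ).trace

theorem gram_isUnit {a : Matrix (Fin n) (Fin m) ℝ} (h : a.rank = m) : IsUnit (aᵀ * a).det :=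
  ((rank_eq_width_iff a).mp h).ne'.isUnit

theorem gram_inv_transpose (a : Matrix (Fin n) (Fin m) ℝ) : ((aᵀ * a)⁻¹)ᵀ = (aᵀ * a)⁻¹ := by
  rw [Matrix.transpose_nonsing_inv, Matrix.transpose_mul, Matrix.transpose_transpose]

/-- Insert (aᵀa)⁻¹(aᵀa) = 1: the form is the squared length of u times the pseudoinverse of a. -/
theorem gramForm_eq_frobeniusSq {a : Matrix (Fin n) (Fin m) ℝ} (h : a.rank = m)
    (u : Matrix (Fin n) (Fin m) ℝ) :
    gramForm a u = frobeniusSq (u * (aᵀ * a)⁻¹ * aᵀ) := by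
  rw [← trace_mul_transpose_self, gramForm]
  congr 1
  rw [Matrix.transpose_mul, Matrix.transpose_mul, Matrix.transpose_transpose, gram_inv_transpose]
  calc u * (aᵀ * a)⁻¹ * uᵀ = u * ((aᵀ * a)⁻¹ * (aᵀ * a)) * ((aᵀ * a)⁻¹ * uᵀ) := by
        rw [Matrix.nonsing_inv_mul _ (gram_isUnit h), Matrix.mul_one, Matrix.mul_assoc]
    _ = _ := by simp only [Matrix.mul_assoc]

theorem gramForm_nonneg {a : Matrix (Fin n) (Fin m) ℝ} (h : a.rank = m)
    (u : Matrix (Fin n) (Fin m) ℝ) : 0 ≤ gramForm a u := by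
  rw [gramForm_eq_frobeniusSq h]; exact frobeniusSq_nonneg _

/-- Since u = (u(aᵀa)⁻¹aᵀ)a, this is submultiplicativity of the Frobenius norm. -/
theorem frobeniusSq_le_gramForm_mul {a : Matrix (Fin n) (Fin m) ℝ} (h : a.rank = m)
    (u : Matrix (Fin n) (Fin m) ℝ) :
    frobeniusSq u ≤ gramForm a u * frobeniusSq a := by
  rw [gramForm_eq_frobeniusSq h]
  refine le_trans (le_of_eq ?_) (frobeniusSq_mul_le _ _)
  rw [Matrix.mul_assoc, Matrix.mul_assoc, Matrix.nonsing_inv_mul _ (gram_isUnit h), Matrix.mul_one]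

theorem gramForm_self {a : Matrix (Fin n) (Fin m) ℝ} (h : a.rank = m) : gramForm a a = m := by
  rw [gramForm, Matrix.trace_mul_comm, ← Matrix.mul_assoc,
    Matrix.mul_nonsing_inv _ (gram_isUnit h), Matrix.trace_one, Fintype.card_fin]

/-- Cauchy–Schwarz for u and a, where a has squared length m (`gramForm_self`); it is read off from
the discriminant of s ↦ `gramForm a (u - s • a)`. -/
theorem trace_sq_le_gramForm {a : Matrix (Fin n) (Fin m) ℝ} (h : a.rank = m)
    (u : Matrix (Fin n) (Fin m) ℝ) :
    ((aᵀ * a)⁻¹ * (aᵀ * u)).trace ^ 2 ≤ m * gramForm a u := by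
  set τ := ((aᵀ * a)⁻¹ * (aᵀ * u)).trace with hτ
  have h1 : (u * (aᵀ * a)⁻¹ * aᵀ).trace = τ := by
    rw [hτ, Matrix.mul_assoc, Matrix.trace_mul_comm, Matrix.mul_assoc]
  have h2 : (a * (aᵀ * a)⁻¹ * uᵀ).trace = τ := by
    rw [← h1, ← Matrix.trace_transpose]
    simp only [Matrix.transpose_mul, Matrix.transpose_transpose, gram_inv_transpose,
      Matrix.mul_assoc]
  have key : ∀ s : ℝ, 0 ≤ m * (s * s) + (-2 * τ) * s + gramForm a u := by
    intro s
    have h3 := gramForm_nonneg h (u - s • a)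
    have h4 : gramForm a (u - s • a) = gramForm a u - s * τ - s * τ + s * s * gramForm a a := by
      rw [gramForm, gramForm, gramForm]
      simp only [Matrix.transpose_sub, Matrix.transpose_smul, Matrix.sub_mul, Matrix.mul_sub,
        Matrix.smul_mul, Matrix.mul_smul, Matrix.trace_sub, Matrix.trace_smul, h1, h2, smul_eq_mul]
      ring
    rw [h4, gramForm_self h] at h3
    linarith
  have := discrim_le_zero key
  rw [discrim] at this
  linarith

theorem matrixMetric_self_eq (a u : Matrix (Fin n) (Fin m) ℝ) :
    matrixMetric a u u = gramForm a u * √(aᵀ * a).det := rfl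

theorem matrixMetricNorm_eq {a : Matrix (Fin n) (Fin m) ℝ} (h : a.rank = m)
    (u : Matrix (Fin n) (Fin m) ℝ) :
    matrixMetricNorm a u = √(gramForm a u) * gramRoot a := by
  rw [matrixMetricNorm, matrixMetric_self_eq, Real.sqrt_mul (gramForm_nonneg h u), gramRoot]

theorem gramForm_smul_right (a u : Matrix (Fin n) (Fin m) ℝ) (r : ℝ) :
    gramForm a (r • u) = r ^ 2 * gramForm a u := by
  simp [gramForm, sq, mul_assoc]

theorem gramForm_smul_left {a : Matrix (Fin n) (Fin m) ℝ} (h : a.rank = m)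
    (u : Matrix (Fin n) (Fin m) ℝ) {r : ℝ} (hr : r ≠ 0) :
    gramForm (r • a) u = (r ^ 2)⁻¹ * gramForm a u := by
  have hu : (r ^ 2 : ℝ) ≠ 0 := pow_ne_zero _ hr
  have h1 : (r • a)ᵀ * (r • a) = (Units.mk0 (r ^ 2) hu) • (aᵀ * a) := by
    rw [Matrix.transpose_smul, Matrix.smul_mul, Matrix.mul_smul, smul_smul, ← sq]
    rfl
  rw [gramForm, h1, Matrix.inv_smul' _ _ (gram_isUnit h), Units.smul_def]
  simp [gramForm]

theorem matrixMetricNorm_smul_right (a u : Matrix (Fin n) (Fin m) ℝ) (r : ℝ) :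
    matrixMetricNorm a (r • u) = |r| * matrixMetricNorm a u := by
  rw [matrixMetricNorm, matrixMetricNorm, matrixMetric_self_eq, matrixMetric_self_eq,
    gramForm_smul_right, mul_assoc, Real.sqrt_mul (sq_nonneg r), Real.sqrt_sq_eq_abs]

theorem rank_smul_eq {a : Matrix (Fin n) (Fin m) ℝ} (h : a.rank = m) {r : ℝ} (hr : 0 < r) :
    (r • a).rank = m := by
  rw [rank_eq_iff_gramRoot_pos] at h ⊢
  rw [gramRoot_smul hr.le]
  positivity

theorem matrixMetricNorm_smul_smul {a : Matrix (Fin n) (Fin m) ℝ} (h : a.rank = m)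
    (u : Matrix (Fin n) (Fin m) ℝ) {r : ℝ} (hr : 0 < r) :
    matrixMetricNorm (r • a) (r • u) = √(r ^ m) * matrixMetricNorm a u := by
  rw [matrixMetricNorm_eq (rank_smul_eq h hr), gramForm_smul_right, gramForm_smul_left h u hr.ne',
    gramRoot_smul hr.le, matrixMetricNorm_eq h, ← mul_assoc (r ^ 2),
    mul_inv_cancel₀ (pow_ne_zero _ hr.ne')]
  ring_nf

theorem matrixMetricNorm_smul_self {a : Matrix (Fin n) (Fin m) ℝ} (h : a.rank = m)
    {r : ℝ} (hr : 0 < r) (q : ℝ) :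
    matrixMetricNorm (r • a) (q • a) = |q / r| * √(r ^ m) * (√m * gramRoot a) := by
  have : q • a = (q / r) • (r • a) := by rw [smul_smul, div_mul_cancel₀ _ hr.ne']
  rw [this, matrixMetricNorm_smul_right, matrixMetricNorm_smul_smul h _ hr, matrixMetricNorm_eq h,
    gramForm_self h, mul_assoc]

theorem continuousAt_matrixMetricNorm {a : Matrix (Fin n) (Fin m) ℝ} (h : a.rank = m)
    (u : Matrix (Fin n) (Fin m) ℝ) :
    ContinuousAt (fun x : Matrix (Fin n) (Fin m) ℝ × Matrix (Fin n) (Fin m) ℝ =>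
      matrixMetricNorm x.1 x.2) (a, u) := by
  have hdet : Continuous fun x : Matrix (Fin n) (Fin m) ℝ × Matrix (Fin n) (Fin m) ℝ =>
      (x.1ᵀ * x.1).det := by fun_prop
  have hadj : Continuous fun x : Matrix (Fin n) (Fin m) ℝ × Matrix (Fin n) (Fin m) ℝ =>
      (x.2 * (x.1ᵀ * x.1).adjugate * x.2ᵀ).trace :=
    ((continuous_snd.matrix_mul (by fun_prop)).matrix_mul (by fun_prop)).matrix_trace
  have h0 : (aᵀ * a).det ≠ 0 := ((rank_eq_width_iff a).mp h).ne'
  -- Writing the inverse as adjugate over determinant leaves only polynomials, one division by a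
  -- nonzero value, and square roots.
  have hform : (fun x : Matrix (Fin n) (Fin m) ℝ × Matrix (Fin n) (Fin m) ℝ =>
      matrixMetricNorm x.1 x.2) = fun x => √(((x.1ᵀ * x.1).det)⁻¹ *
        (x.2 * (x.1ᵀ * x.1).adjugate * x.2ᵀ).trace * √(x.1ᵀ * x.1).det) := by
    funext x
    simp [matrixMetricNorm, matrixMetric, Matrix.inv_def]
  rw [hform]
  exact (((hdet.continuousAt.inv₀ h0).mul hadj.continuousAt).mul
    hdet.continuousAt.sqrt).sqrt

/-- Jacobi's formula. In the Leibniz expansion, differentiating the factors of column i gives the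
determinant with that column replaced by the one of `H`, which Cramer's rule expresses through the
adjugate. -/
theorem hasDerivAt_matrix_det {k : ℕ} {M : ℝ → Matrix (Fin k) (Fin k) ℝ}
    {H : Matrix (Fin k) (Fin k) ℝ} {t : ℝ}
    (hM : ∀ i j, HasDerivAt (fun s => M s i j) (H i j) t) :
    HasDerivAt (fun s => (M s).det) ((M t).adjugate * H).trace t := by
  have h1 : HasDerivAt (fun s => ∑ σ : Equiv.Perm (Fin k),
      ((Equiv.Perm.sign σ : ℤ) : ℝ) * ∏ i, M s (σ i) i)
      (∑ σ : Equiv.Perm (Fin k), ((Equiv.Perm.sign σ : ℤ) : ℝ) *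
        ∑ i, (∏ j ∈ Finset.univ.erase i, M t (σ j) j) • H (σ i) i) t :=
    HasDerivAt.fun_sum fun σ _ =>
      (HasDerivAt.fun_finsetProd fun i _ => hM (σ i) i).const_mul _
  have h2 : (∑ σ : Equiv.Perm (Fin k), ((Equiv.Perm.sign σ : ℤ) : ℝ) *
        ∑ i, (∏ j ∈ Finset.univ.erase i, M t (σ j) j) • H (σ i) i)
      = ((M t).adjugate * H).trace := by
    simp only [Finset.mul_sum]
    rw [Finset.sum_comm, Matrix.trace]
    refine Finset.sum_congr rfl fun i _ => ?_
    have h3 : ((M t).adjugate * H).diag i = ((M t).updateCol i (fun l => H l i)).det := by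
      rw [← Matrix.cramer_apply, Matrix.cramer_eq_adjugate_mulVec]
      rfl
    rw [h3, Matrix.det_apply']
    refine Finset.sum_congr rfl fun σ _ => ?_
    rw [← Finset.mul_prod_erase _ _ (Finset.mem_univ i), Matrix.updateCol_self, smul_eq_mul,
      mul_comm (H (σ i) i)]
    congr 2
    refine Finset.prod_congr rfl fun j hj => ?_
    rw [Matrix.updateCol_ne (Finset.ne_of_mem_erase hj)]
  rw [← h2]
  simpa only [Matrix.det_apply'] using h1

theorem hasDerivAt_gramRoot {γ : ℝ → Matrix (Fin n) (Fin m) ℝ} {u : Matrix (Fin n) (Fin m) ℝ}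
    {t : ℝ} (hγ : ∀ i j, HasDerivAt (fun s => γ s i j) (u i j) t) (h : (γ t).rank = m) :
    HasDerivAt (fun s => gramRoot (γ s))
      (gramRoot (γ t) * (((γ t)ᵀ * γ t)⁻¹ * ((γ t)ᵀ * u)).trace / 2) t := by
  set a := γ t with ha
  have hG : ∀ i j, HasDerivAt (fun s => ((γ s)ᵀ * γ s) i j) ((uᵀ * a + aᵀ * u) i j) t := by
    intro i j
    simp only [Matrix.mul_apply, Matrix.add_apply, Matrix.transpose_apply,
      ← Finset.sum_add_distrib]
    exact HasDerivAt.fun_sum fun l _ => (hγ l i).mul (hγ l j)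
  have h0 : 0 < (aᵀ * a).det := (rank_eq_width_iff a).mp h
  have h1 := ((hasDerivAt_matrix_det hG).sqrt h0.ne').sqrt (Real.sqrt_pos.mpr h0).ne'
  rw [← ha] at h1
  refine h1.congr_deriv ?_
  have hadj : (aᵀ * a).adjugate = (aᵀ * a).det • (aᵀ * a)⁻¹ := by
    rw [Matrix.inv_def, smul_smul, Ring.inverse_eq_inv', mul_inv_cancel₀ h0.ne', one_smul]
  have hsym : ((aᵀ * a)⁻¹ * (uᵀ * a)).trace = ((aᵀ * a)⁻¹ * (aᵀ * u)).trace := by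
    rw [← Matrix.trace_transpose, Matrix.trace_mul_comm]
    simp only [Matrix.transpose_mul, Matrix.transpose_transpose, gram_inv_transpose]
  have htr : ((aᵀ * a).adjugate * (uᵀ * a + aᵀ * u)).trace
      = (aᵀ * a).det * (2 * ((aᵀ * a)⁻¹ * (aᵀ * u)).trace) := by
    rw [hadj, Matrix.smul_mul, Matrix.trace_smul, Matrix.mul_add, Matrix.trace_add, hsym,
      smul_eq_mul]
    ring
  rw [htr, gramRoot]
  set d := (aᵀ * a).det
  -- With d = f⁴ and √d = f², the claim becomes a rational identity in f.
  have hd : d = √√d ^ 4 := by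
    rw [show √√d ^ 4 = (√√d ^ 2) ^ 2 by ring, Real.sq_sqrt (Real.sqrt_nonneg _),
      Real.sq_sqrt h0.le]
  have hq : √d = √√d ^ 2 := (Real.sq_sqrt (Real.sqrt_nonneg _)).symm
  have hp : 0 < √√d := Real.sqrt_pos.mpr (Real.sqrt_pos.mpr h0)
  generalize √√d = f at *
  rw [hq, hd]
  field_simp

end LinearAlgebra

/-! ### Admissible curves and their length. -/

section Curves

variable {n m : ℕ}

namespace IsAdmissibleCurve

theorem exists_hasDerivAt {a b : FullRankMatrix n m} {γ : ℝ → Matrix (Fin n) (Fin m) ℝ}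
    (h : IsAdmissibleCurve a b γ) :
    ∃ S : Finset ℝ, ∀ t ∈ Ioo (0 : ℝ) 1 \ (S : Set ℝ), ∀ i j,
      HasDerivAt (fun s => γ s i j) (curveVelocity γ t i j) t := by
  obtain ⟨S, hS⟩ := h.piecewise_contDiffOn
  refine ⟨S, fun t ht i j => ?_⟩
  have hopen : IsOpen (Ioo (0 : ℝ) 1 \ (S : Set ℝ)) :=
    isOpen_Ioo.sdiff S.finite_toSet.isClosed
  obtain ⟨ε, hε, hball⟩ := Metric.isOpen_iff.mp hopen t ht
  have hsub : Icc (t - ε / 2) (t + ε / 2) ⊆ Ioo (0 : ℝ) 1 \ (S : Set ℝ) := fun x hx =>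
    hball (by rw [Metric.mem_ball, Real.dist_eq, abs_lt]; constructor <;> linarith [hx.1, hx.2])
  have hl := hsub (left_mem_Icc.mpr (by linarith))
  have hr := hsub (right_mem_Icc.mpr (by linarith))
  have hC := hS (t - ε / 2) (t + ε / 2) hl.1.1.le hr.1.2.le
    (fun s hs hs' => (hsub (Ioo_subset_Icc_self hs')).2 hs) i j
  exact ((hC.contDiffAt (Icc_mem_nhds (by linarith) (by linarith))).differentiableAt
    one_ne_zero).hasDerivAt

theorem of_contDiffOn {a b : FullRankMatrix n m} {γ : ℝ → Matrix (Fin n) (Fin m) ℝ}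
    (hC : ∀ i j, ContDiffOn ℝ 1 (fun t => γ t i j) (Icc 0 1))
    (hrank : ∀ t ∈ Icc (0 : ℝ) 1, (γ t).rank = m) (h0 : γ 0 = a) (h1 : γ 1 = b) :
    IsAdmissibleCurve a b γ where
  continuousOn := continuousOn_pi.mpr fun i => continuousOn_pi.mpr fun j => (hC i j).continuousOn
  rank_eq := hrank
  piecewise_contDiffOn := ⟨∅, fun _ _ hc hd _ i j => (hC i j).mono (Icc_subset_Icc hc hd)⟩
  source := h0
  target := h1

theorem continuousOn_apply {a b : FullRankMatrix n m} {γ : ℝ → Matrix (Fin n) (Fin m) ℝ}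
    (h : IsAdmissibleCurve a b γ) (i : Fin n) (j : Fin m) :
    ContinuousOn (fun t => γ t i j) (Icc 0 1) :=
  continuousOn_pi.mp (continuousOn_pi.mp h.continuousOn i) j

end IsAdmissibleCurve

theorem geodesicEDist_le_curveLength {a b : FullRankMatrix n m}
    {γ : ℝ → Matrix (Fin n) (Fin m) ℝ} (h : IsAdmissibleCurve a b γ) :
    geodesicEDist a b ≤ curveLength γ := iInf₂_le γ h

theorem exists_curveLength_lt {a b : FullRankMatrix n m} {L : ℝ≥0∞}
    (h : geodesicEDist a b < L) :
    ∃ γ, IsAdmissibleCurve a b γ ∧ curveLength γ < L := by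
  simpa [geodesicEDist, iInf_lt_iff] using h

theorem curveLength_le_of_speed_le {γ : ℝ → Matrix (Fin n) (Fin m) ℝ} {C : ℝ}
    (h : ∀ t ∈ Ioo (0 : ℝ) 1, matrixMetricNorm (γ t) (curveVelocity γ t) ≤ C) :
    curveLength γ ≤ ENNReal.ofReal C := by
  -- The endpoints are discarded: `deriv` there depends on values of γ outside [0,1], which are
  -- arbitrary.
  rw [curveLength, setLIntegral_congr Ioo_ae_eq_Icc.symm]
  calc ∫⁻ t in Ioo (0 : ℝ) 1, ENNReal.ofReal (matrixMetricNorm (γ t) (curveVelocity γ t))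
      ≤ ∫⁻ _ in Ioo (0 : ℝ) 1, ENNReal.ofReal C :=
        setLIntegral_mono' measurableSet_Ioo fun t ht => ENNReal.ofReal_le_ofReal (h t ht)
    _ = ENNReal.ofReal C := by simp

/-- A function along a curve whose derivative is at most `K` times the speed of the curve
changes by at most `K` times the length of the curve. -/
theorem abs_sub_le_mul_of_curveLength_le {γ : ℝ → Matrix (Fin n) (Fin m) ℝ} {L K : ℝ}
    (hL : 0 ≤ L) (hK : 0 ≤ K) (hγ : curveLength γ ≤ ENNReal.ofReal L) {φ φ' : ℝ → ℝ}
    {S : Set ℝ} (hS : S.Countable) (hc : ContinuousOn φ (Icc 0 1))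
    (hd : ∀ t ∈ Ioo (0 : ℝ) 1 \ S, HasDerivAt φ (φ' t) t)
    (hb : ∀ t ∈ Ioo (0 : ℝ) 1 \ S, |φ' t| ≤ K * matrixMetricNorm (γ t) (curveVelocity γ t))
    {s : ℝ} (hs : s ∈ Icc (0 : ℝ) 1) : |φ s - φ 0| ≤ K * L := by
  have hae : ∀ᵐ t ∂(volume.restrict (Ioc 0 s)), t ∈ Ioo (0 : ℝ) 1 \ S := by
    have h1 : ∀ᵐ t ∂(volume : Measure ℝ), t ∉ S ∪ {1} :=
      measure_eq_zero_iff_ae_notMem.mp ((hS.union (countable_singleton 1)).measure_zero _)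
    filter_upwards [ae_restrict_of_ae h1, ae_restrict_mem measurableSet_Ioc] with t ht1 ht2
    refine ⟨⟨ht2.1, lt_of_le_of_ne (ht2.2.trans hs.2) fun h => ht1 (Or.inr h)⟩,
      fun h => ht1 (Or.inl h)⟩
  have hbound : ∫⁻ t in Ioc 0 s, ‖deriv φ t‖ₑ ≤ ENNReal.ofReal (K * L) := by
    calc ∫⁻ t in Ioc 0 s, ‖deriv φ t‖ₑ
        ≤ ∫⁻ t in Ioc 0 s, ENNReal.ofReal K *
            ENNReal.ofReal (matrixMetricNorm (γ t) (curveVelocity γ t)) := by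
          refine lintegral_mono_ae ?_
          filter_upwards [hae] with t ht
          rw [(hd t ht).deriv, Real.enorm_eq_ofReal_abs, ← ENNReal.ofReal_mul hK]
          exact ENNReal.ofReal_le_ofReal (hb t ht)
      _ = ENNReal.ofReal K * ∫⁻ t in Ioc 0 s,
            ENNReal.ofReal (matrixMetricNorm (γ t) (curveVelocity γ t)) :=
          lintegral_const_mul' _ _ ENNReal.ofReal_ne_top
      _ ≤ ENNReal.ofReal K * curveLength γ := by
          gcongr
          exact lintegral_mono_set fun t ht => ⟨ht.1.le, ht.2.trans hs.2⟩
      _ ≤ ENNReal.ofReal K * ENNReal.ofReal L := by gcongr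
      _ = _ := (ENNReal.ofReal_mul hK).symm
  -- Finite length makes the derivative integrable, which is what the fundamental theorem with a
  -- countable exceptional set requires.
  have hint : IntegrableOn (deriv φ) (Ioc 0 s) :=
    ⟨(measurable_deriv φ).aestronglyMeasurable, hbound.trans_lt ENNReal.ofReal_lt_top⟩
  have hftc : ∫ t in (0 : ℝ)..s, deriv φ t = φ s - φ 0 :=
    integral_eq_of_hasDerivAt_off_countable_of_le φ (deriv φ) hs.1 hS
      (hc.mono (Icc_subset_Icc_right hs.2))
      (fun t ht => (hd t ⟨⟨ht.1.1, ht.1.2.trans_le hs.2⟩, ht.2⟩).differentiableAt.hasDerivAt)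
      ((intervalIntegrable_iff_integrableOn_Ioc_of_le hs.1).mpr hint)
  rw [← hftc, intervalIntegral.integral_of_le hs.1, ← Real.norm_eq_abs,
    ← ENNReal.ofReal_le_ofReal_iff (mul_nonneg hK hL), ofReal_norm]
  exact (enorm_integral_le_lintegral_enorm _).trans hbound

/-! ### Reparametrisation, reversal and concatenation: the distance is a pseudometric. -/

theorem curveVelocity_congr {γ γ' : ℝ → Matrix (Fin n) (Fin m) ℝ} {t : ℝ} (h : γ =ᶠ[𝓝 t] γ') :
    curveVelocity γ t = curveVelocity γ' t := by
  ext i j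
  exact (h.fun_comp fun a => a i j).deriv_eq

theorem curveVelocity_comp_affine (γ : ℝ → Matrix (Fin n) (Fin m) ℝ) (p q t : ℝ) :
    curveVelocity (fun s => γ (p * s + q)) t = p • curveVelocity γ (p * t + q) := by
  ext i j
  simp only [curveVelocity, Matrix.of_apply, Matrix.smul_apply]
  exact (deriv_comp_mul_left p (fun y => γ (y + q) i j) t).trans
    (congrArg (p • ·) (deriv_comp_add_const (fun y => γ y i j) q (p * t)))

theorem setLIntegral_speed_comp_affine (γ : ℝ → Matrix (Fin n) (Fin m) ℝ) {p : ℝ} (hp : p ≠ 0)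
    (q : ℝ) {s : Set ℝ} (hs : MeasurableSet s) :
    ∫⁻ t in s, ENNReal.ofReal (matrixMetricNorm (γ (p * t + q))
        (curveVelocity (fun t => γ (p * t + q)) t)) =
      ∫⁻ t in (fun t => p * t + q) '' s,
        ENNReal.ofReal (matrixMetricNorm (γ t) (curveVelocity γ t)) := by
  rw [lintegral_image_eq_lintegral_abs_deriv_mul (f' := fun _ => p) hs]
  · refine lintegral_congr fun t => ?_
    rw [curveVelocity_comp_affine, matrixMetricNorm_smul_right, ENNReal.ofReal_mul (abs_nonneg p)]
  · intro x _
    simpa using (((hasDerivAt_id x).const_mul p).add_const q).hasDerivWithinAt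
  · intro x _ y _ hxy
    simpa [hp] using hxy

theorem contDiffOn_comp_affine {f : ℝ → ℝ} {p q c d c' d' : ℝ}
    (h : ContDiffOn ℝ 1 f (Icc c' d')) (hmap : ∀ t ∈ Icc c d, p * t + q ∈ Icc c' d') :
    ContDiffOn ℝ 1 (fun t => f (p * t + q)) (Icc c d) :=
  h.comp (g := f) (f := fun t => p * t + q) (by fun_prop) hmap

theorem geodesicEDist_self (a : FullRankMatrix n m) : geodesicEDist a a = 0 := by
  have h : IsAdmissibleCurve a a fun _ => (a : Matrix (Fin n) (Fin m) ℝ) :=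
    .of_contDiffOn (fun _ _ => contDiffOn_const) (fun _ _ => a.2) rfl rfl
  refine le_antisymm ((geodesicEDist_le_curveLength h).trans ?_) zero_le
  have hv : ∀ t, curveVelocity (fun _ : ℝ => (a : Matrix (Fin n) (Fin m) ℝ)) t = 0 := fun t => by
    ext i j; simp [curveVelocity]
  simp [curveLength, hv, matrixMetricNorm, matrixMetric]

theorem geodesicEDist_comm_le (a b : FullRankMatrix n m) :
    geodesicEDist b a ≤ geodesicEDist a b := by
  refine le_iInf₂ fun γ h => ?_
  have hmap : ∀ t ∈ Icc (0 : ℝ) 1, -1 * t + 1 ∈ Icc (0 : ℝ) 1 := fun t ht =>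
    ⟨by linarith [ht.2], by linarith [ht.1]⟩
  have hadm : IsAdmissibleCurve b a fun t => γ (-1 * t + 1) := by
    obtain ⟨S, hS⟩ := h.piecewise_contDiffOn
    refine ⟨h.continuousOn.comp (by fun_prop) hmap, fun t ht => h.rank_eq _ (hmap t ht),
      ⟨S.image fun t => -1 * t + 1, fun c d hc hd hcd i j => ?_⟩, by simp [h.target],
      by simp [h.source]⟩
    refine contDiffOn_comp_affine (c' := 1 - d) (d' := 1 - c)
      (hS (1 - d) (1 - c) (by linarith) (by linarith) (fun s hs hs' => ?_) i j)
      fun t ht => ⟨by linarith [ht.2], by linarith [ht.1]⟩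
    exact hcd _ (Finset.mem_image_of_mem _ hs) ⟨by linarith [hs'.2], by linarith [hs'.1]⟩
  refine (geodesicEDist_le_curveLength hadm).trans ?_
  rw [curveLength, setLIntegral_speed_comp_affine γ (by norm_num) 1 measurableSet_Icc]
  exact lintegral_mono_set (image_subset_iff.mpr hmap)

theorem geodesicEDist_comm (a b : FullRankMatrix n m) :
    geodesicEDist a b = geodesicEDist b a :=
  le_antisymm (geodesicEDist_comm_le b a) (geodesicEDist_comm_le a b)

/-- The concatenation of two curves, each run through at double speed. -/
def curveConcat (γ₁ γ₂ : ℝ → Matrix (Fin n) (Fin m) ℝ) (t : ℝ) : Matrix (Fin n) (Fin m) ℝ :=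
  if t ≤ 1 / 2 then γ₁ (2 * t + 0) else γ₂ (2 * t + -1)

theorem curveConcat_of_le (γ₁ γ₂ : ℝ → Matrix (Fin n) (Fin m) ℝ) {t : ℝ} (ht : t ≤ 1 / 2) :
    curveConcat γ₁ γ₂ t = γ₁ (2 * t + 0) := if_pos ht

theorem curveConcat_of_ge {γ₁ γ₂ : ℝ → Matrix (Fin n) (Fin m) ℝ} (h : γ₁ 1 = γ₂ 0) {t : ℝ}
    (ht : 1 / 2 ≤ t) : curveConcat γ₁ γ₂ t = γ₂ (2 * t + -1) := by
  rcases ht.eq_or_lt with rfl | ht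
  · rw [curveConcat_of_le _ _ le_rfl]; norm_num [h]
  · exact if_neg (not_le.mpr ht)

theorem IsAdmissibleCurve.concat {a b c : FullRankMatrix n m}
    {γ₁ γ₂ : ℝ → Matrix (Fin n) (Fin m) ℝ} (h₁ : IsAdmissibleCurve a b γ₁)
    (h₂ : IsAdmissibleCurve b c γ₂) : IsAdmissibleCurve a c (curveConcat γ₁ γ₂) := by
  have hbc : γ₁ 1 = γ₂ 0 := h₁.target.trans h₂.source.symm
  obtain ⟨S₁, hS₁⟩ := h₁.piecewise_contDiffOn
  obtain ⟨S₂, hS₂⟩ := h₂.piecewise_contDiffOn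
  have hm₁ : ∀ t ∈ Icc (0 : ℝ) (1 / 2), 2 * t + 0 ∈ Icc (0 : ℝ) 1 := fun t ht =>
    ⟨by linarith [ht.1], by linarith [ht.2]⟩
  have hm₂ : ∀ t ∈ Icc (1 / 2 : ℝ) 1, 2 * t + -1 ∈ Icc (0 : ℝ) 1 := fun t ht =>
    ⟨by linarith [ht.1], by linarith [ht.2]⟩
  refine ⟨?_, fun t ht => ?_, ⟨insert (1 / 2) ((S₁.image fun s => s / 2) ∪
    S₂.image fun s => (s + 1) / 2), fun x y hx hy hxy i j => ?_⟩, ?_, ?_⟩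
  · rw [← Icc_union_Icc_eq_Icc (by norm_num : (0 : ℝ) ≤ 1 / 2) (by norm_num : (1 / 2 : ℝ) ≤ 1)]
    refine ContinuousOn.union_of_isClosed ?_ ?_ isClosed_Icc isClosed_Icc
    · exact (h₁.continuousOn.comp (by fun_prop) hm₁).congr fun t ht =>
        curveConcat_of_le _ _ ht.2
    · exact (h₂.continuousOn.comp (by fun_prop) hm₂).congr fun t ht =>
        curveConcat_of_ge hbc ht.1
  · rcases le_total t (1 / 2) with h | h
    · rw [curveConcat_of_le _ _ h]; exact h₁.rank_eq _ (hm₁ t ⟨ht.1, h⟩)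
    · rw [curveConcat_of_ge hbc h]; exact h₂.rank_eq _ (hm₂ t ⟨h, ht.2⟩)
  · have hhalf : ¬ (x < 1 / 2 ∧ 1 / 2 < y) := fun h => hxy (1 / 2) (by simp) h
    rcases le_or_gt y (1 / 2) with h | h
    · refine ContDiffOn.congr (contDiffOn_comp_affine (p := 2) (q := 0) (c' := 2 * x)
        (d' := 2 * y) (hS₁ (2 * x) (2 * y) (by linarith) (by linarith) (fun s hs hs' => ?_) i j)
        fun t ht => ⟨by linarith [ht.1], by linarith [ht.2]⟩) fun t ht => ?_
      · refine hxy (s / 2) ?_ ⟨by linarith [hs'.1], by linarith [hs'.2]⟩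
        exact Finset.mem_insert_of_mem
          (Finset.mem_union_left _ (Finset.mem_image_of_mem (fun s => s / 2) hs))
      · rw [curveConcat_of_le _ _ (ht.2.trans h)]
    · have h' : 1 / 2 ≤ x := not_lt.mp fun hx => hhalf ⟨hx, h⟩
      refine ContDiffOn.congr (contDiffOn_comp_affine (p := 2) (q := -1) (c' := 2 * x - 1)
        (d' := 2 * y - 1) (hS₂ (2 * x - 1) (2 * y - 1) (by linarith) (by linarith)
          (fun s hs hs' => ?_) i j)
        fun t ht => ⟨by linarith [ht.1], by linarith [ht.2]⟩) fun t ht => ?_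
      · refine hxy ((s + 1) / 2) ?_ ⟨by linarith [hs'.1], by linarith [hs'.2]⟩
        exact Finset.mem_insert_of_mem
          (Finset.mem_union_right _ (Finset.mem_image_of_mem (fun s => (s + 1) / 2) hs))
      · rw [curveConcat_of_ge hbc (h'.trans ht.1)]
  · rw [curveConcat_of_le _ _ (by norm_num)]; simp [h₁.source]
  · rw [curveConcat_of_ge hbc (by norm_num)]; norm_num [h₂.target]

theorem curveLength_concat_le {γ₁ γ₂ : ℝ → Matrix (Fin n) (Fin m) ℝ} (h : γ₁ 1 = γ₂ 0) :
    curveLength (curveConcat γ₁ γ₂) ≤ curveLength γ₁ + curveLength γ₂ := by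
  set F := fun t => ENNReal.ofReal (matrixMetricNorm (curveConcat γ₁ γ₂ t)
    (curveVelocity (curveConcat γ₁ γ₂) t)) with hF
  have hl : ∫⁻ t in Ioc (0 : ℝ) (1 / 2), F t ≤ curveLength γ₁ := by
    rw [setLIntegral_congr Ioo_ae_eq_Ioc.symm]
    have hcongr : ∀ t ∈ Ioo (0 : ℝ) (1 / 2), F t = ENNReal.ofReal (matrixMetricNorm
        (γ₁ (2 * t + 0)) (curveVelocity (fun t => γ₁ (2 * t + 0)) t)) := by
      intro t ht
      -- Agreement near t, not only at t, is needed because the speed involves `deriv`; the midpoint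
      -- is excluded for this reason.
      have hev : curveConcat γ₁ γ₂ =ᶠ[𝓝 t] fun t => γ₁ (2 * t + 0) :=
        eventually_of_mem (Iic_mem_nhds ht.2) fun s hs => curveConcat_of_le _ _ hs
      rw [hF, ← curveVelocity_congr hev, ← hev.eq_of_nhds]
    rw [setLIntegral_congr_fun measurableSet_Ioo hcongr,
      setLIntegral_speed_comp_affine γ₁ two_ne_zero 0 measurableSet_Ioo]
    exact lintegral_mono_set (image_subset_iff.mpr fun t ht =>
      ⟨by linarith [ht.1], by linarith [ht.2]⟩)
  have hr : ∫⁻ t in Ioo (1 / 2 : ℝ) 1, F t ≤ curveLength γ₂ := by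
    have hcongr : ∀ t ∈ Ioo (1 / 2 : ℝ) 1, F t = ENNReal.ofReal (matrixMetricNorm
        (γ₂ (2 * t + -1)) (curveVelocity (fun t => γ₂ (2 * t + -1)) t)) := by
      intro t ht
      have hev : curveConcat γ₁ γ₂ =ᶠ[𝓝 t] fun t => γ₂ (2 * t + -1) :=
        eventually_of_mem (Ici_mem_nhds ht.1) fun s hs => curveConcat_of_ge h hs
      rw [hF, ← curveVelocity_congr hev, ← hev.eq_of_nhds]
    rw [setLIntegral_congr_fun measurableSet_Ioo hcongr,
      setLIntegral_speed_comp_affine γ₂ two_ne_zero (-1) measurableSet_Ioo]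
    exact lintegral_mono_set (image_subset_iff.mpr fun t ht =>
      ⟨by linarith [ht.1], by linarith [ht.2]⟩)
  calc curveLength (curveConcat γ₁ γ₂) = ∫⁻ t in Ioo (0 : ℝ) 1, F t :=
        setLIntegral_congr Ioo_ae_eq_Icc.symm
    _ ≤ ∫⁻ t in Ioc (0 : ℝ) (1 / 2) ∪ Ioo (1 / 2) 1, F t := by
        refine lintegral_mono_set fun t ht => ?_
        rcases le_or_gt t (1 / 2) with h | h
        · exact Or.inl ⟨ht.1, h⟩
        · exact Or.inr ⟨h, ht.2⟩
    _ ≤ _ := (lintegral_union_le _ _ _).trans (add_le_add hl hr)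

theorem geodesicEDist_triangle (a b c : FullRankMatrix n m) :
    geodesicEDist a c ≤ geodesicEDist a b + geodesicEDist b c := by
  refine ENNReal.le_of_forall_pos_le_add fun ε hε hfin => ?_
  have hε' : (ε : ℝ≥0∞) / 2 ≠ 0 := by simpa using hε.ne'
  obtain ⟨γ₁, h₁, hl₁⟩ := exists_curveLength_lt
    (ENNReal.lt_add_right (lt_of_le_of_lt le_self_add hfin).ne hε')
  obtain ⟨γ₂, h₂, hl₂⟩ := exists_curveLength_lt
    (ENNReal.lt_add_right (lt_of_le_of_lt le_add_self hfin).ne hε')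
  calc geodesicEDist a c ≤ curveLength γ₁ + curveLength γ₂ :=
        (geodesicEDist_le_curveLength (h₁.concat h₂)).trans
          (curveLength_concat_le (h₁.target.trans h₂.source.symm))
    _ ≤ (geodesicEDist a b + ε / 2) + (geodesicEDist b c + ε / 2) := add_le_add hl₁.le hl₂.le
    _ = geodesicEDist a b + geodesicEDist b c + ε := by
        rw [add_add_add_comm, ENNReal.add_halves]

end Curves

/-! ### Connectedness of the full-rank matrices and local comparison with the usual topology. -/

section Connectivity

variable {n m : ℕ}

theorem curveVelocity_segment (a u : Matrix (Fin n) (Fin m) ℝ) (t : ℝ) :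
    curveVelocity (fun t => a + t • u) t = u := by
  ext i j
  simp [curveVelocity]

theorem isAdmissibleCurve_segment {a b : FullRankMatrix n m}
    {u : Matrix (Fin n) (Fin m) ℝ} (hu : (a : Matrix (Fin n) (Fin m) ℝ) + u = b)
    (h : ∀ t ∈ Icc (0 : ℝ) 1, ((a : Matrix (Fin n) (Fin m) ℝ) + t • u).rank = m) :
    IsAdmissibleCurve a b fun t => (a : Matrix (Fin n) (Fin m) ℝ) + t • u := by
  refine .of_contDiffOn (fun i j => ?_) h (by simp) (by simpa using hu)
  simp only [Matrix.add_apply, Matrix.smul_apply, smul_eq_mul]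
  fun_prop

theorem geodesicEDist_lt_top_of_segment {a b : FullRankMatrix n m}
    {u : Matrix (Fin n) (Fin m) ℝ} (hu : (a : Matrix (Fin n) (Fin m) ℝ) + u = b)
    (h : ∀ t ∈ Icc (0 : ℝ) 1, ((a : Matrix (Fin n) (Fin m) ℝ) + t • u).rank = m) :
    geodesicEDist a b < ∞ := by
  have hc : ContinuousOn (fun t : ℝ => matrixMetricNorm (a.1 + t • u) u) (Icc 0 1) := by
    intro t ht
    have h1 : Continuous fun t : ℝ => (a.1 + t • u, u) := by fun_prop
    have h2 := ContinuousAt.comp (x := t)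
      (g := fun x : Matrix (Fin n) (Fin m) ℝ × Matrix (Fin n) (Fin m) ℝ =>
        matrixMetricNorm x.1 x.2) (f := fun t : ℝ => (a.1 + t • u, u))
      (continuousAt_matrixMetricNorm (h t ht) u) h1.continuousAt
    exact h2.continuousWithinAt
  obtain ⟨C, hC⟩ := isCompact_Icc.bddAbove_image hc
  refine ((geodesicEDist_le_curveLength (isAdmissibleCurve_segment hu h)).trans
    (curveLength_le_of_speed_le (C := C) fun t ht => ?_)).trans_lt ENNReal.ofReal_lt_top
  rw [curveVelocity_segment]
  exact hC (mem_image_of_mem _ (Ioo_subset_Icc_self ht))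

/-- A kernel vector v of the perturbed matrix satisfies av = -(t·v k)w; as w is outside the column
space, both sides vanish. Thus a column may be moved along a segment in any such direction. -/
theorem rank_add_smul_vecMulVec {a : Matrix (Fin n) (Fin m) ℝ} (h : a.rank = m) (k : Fin m)
    {w : Fin n → ℝ} (hw : w ∉ LinearMap.range a.mulVecLin) (t : ℝ) :
    (a + t • Matrix.vecMulVec w (Pi.single k 1)).rank = m := by
  refine rank_eq_width_of_mulVec_ne_zero fun v hv => ?_
  rw [Matrix.add_mulVec, Matrix.smul_mulVec, Matrix.vecMulVec_mulVec, single_one_dotProduct,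
    op_smul_eq_smul, smul_smul] at hv
  rcases eq_or_ne (t * v k) 0 with h0 | h0
  · rw [h0, zero_smul, add_zero] at hv
    exact mulVec_eq_zero_of_rank_eq h hv
  · refine absurd ⟨-(t * v k)⁻¹ • v, ?_⟩ hw
    rw [Matrix.mulVecLin_apply, Matrix.mulVec_smul, eq_neg_of_add_eq_zero_left hv, smul_neg,
      neg_smul, neg_neg, smul_smul, inv_mul_cancel₀ h0, one_smul]

theorem range_mulVecLin_ne_top (hnm : m < n) (a : Matrix (Fin n) (Fin m) ℝ) :
    LinearMap.range a.mulVecLin ≠ ⊤ := by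
  intro h
  have h1 : a.rank = n := by rw [Matrix.rank, h]; simp
  have := a.rank_le_width
  omega

theorem exists_geodesicEDist_lt_top_col_eq {a : FullRankMatrix n m} (k : Fin m) {z : Fin n → ℝ}
    (hz : z ∉ LinearMap.range (a : Matrix (Fin n) (Fin m) ℝ).mulVecLin) :
    ∃ b : FullRankMatrix n m, geodesicEDist a b < ∞ ∧ (∀ i, b.1 i k = z i) ∧
      ∀ j ≠ k, ∀ i, b.1 i j = a.1 i j := by
  have hw : (z - fun i => a.1 i k) ∉ LinearMap.range a.1.mulVecLin := by
    intro hmem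
    refine hz ?_
    have hcol : (fun i => a.1 i k) ∈ LinearMap.range a.1.mulVecLin :=
      ⟨Pi.single k 1, by ext i; simp⟩
    simpa using add_mem hmem hcol
  have hr := rank_add_smul_vecMulVec a.2 k hw
  refine ⟨⟨a.1 + (1 : ℝ) • Matrix.vecMulVec (z - fun i => a.1 i k) (Pi.single k 1), hr 1⟩,
    geodesicEDist_lt_top_of_segment (u := Matrix.vecMulVec (z - fun i => a.1 i k) (Pi.single k 1))
      (by simp) fun t _ => hr t, fun i => ?_, fun j hj i => ?_⟩
  · simp [Matrix.vecMulVec_apply]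
  · simp [Matrix.vecMulVec_apply, hj]

/-- Induction on columns: replace the l-th column of both matrices by a common vector outside both
column spaces, until the two matrices coincide. -/
theorem geodesicEDist_lt_top (hnm : m < n) (a b : FullRankMatrix n m) :
    geodesicEDist a b < ∞ := by
  have key : ∀ l ≤ m, ∃ a' b' : FullRankMatrix n m, geodesicEDist a a' < ∞ ∧
      geodesicEDist b b' < ∞ ∧ ∀ j : Fin m, j.val < l → ∀ i, a'.1 i j = b'.1 i j := by
    intro l
    induction l with
    | zero =>
      exact fun _ => ⟨a, b, by simp [geodesicEDist_self], by simp [geodesicEDist_self],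
        fun j hj => absurd hj (by omega)⟩
    | succ l ih =>
      intro hl
      obtain ⟨a', b', ha, hb, hab⟩ := ih (by omega)
      -- A real vector space is not a union of two proper subspaces; the column spaces are proper
      -- because m < n.
      obtain ⟨z, hz⟩ : ∃ z : Fin n → ℝ, ∀ i : Bool,
          z ∉ LinearMap.range (cond i a' b').1.mulVecLin := by
        by_contra! hcon
        obtain ⟨i, hi⟩ := Subspace.exists_eq_top_of_iUnion_eq_univ (k := ℝ)
          (p := fun i : Bool => LinearMap.range (cond i a' b').1.mulVecLin)
          (eq_univ_of_forall fun z => mem_iUnion.mpr (hcon z))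
        exact range_mulVecLin_ne_top hnm _ hi
      obtain ⟨a'', h1, h2, h3⟩ := exists_geodesicEDist_lt_top_col_eq ⟨l, hl⟩ (hz true)
      obtain ⟨b'', h4, h5, h6⟩ := exists_geodesicEDist_lt_top_col_eq ⟨l, hl⟩ (hz false)
      refine ⟨a'', b'', (geodesicEDist_triangle a a' a'').trans_lt (ENNReal.add_lt_top.mpr ⟨ha, h1⟩),
        (geodesicEDist_triangle b b' b'').trans_lt (ENNReal.add_lt_top.mpr ⟨hb, h4⟩),
        fun j hj i => ?_⟩
      rcases eq_or_ne j ⟨l, hl⟩ with rfl | hne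
      · rw [h2, h5]
      · rw [h3 j hne, h6 j hne]
        exact hab j (lt_of_le_of_ne (Nat.lt_succ_iff.mp hj) fun h => hne (Fin.ext h)) i
  obtain ⟨a', b', ha, hb, hab⟩ := key m le_rfl
  obtain rfl : a' = b' := Subtype.ext (by ext i j; exact hab j j.2 i)
  exact (geodesicEDist_triangle a a' b).trans_lt
    (ENNReal.add_lt_top.mpr ⟨ha, by rwa [geodesicEDist_comm]⟩)

/-- Close to a full rank matrix, all matrices have full rank and small geodesic distance. -/
theorem eventually_geodesicEDist_le (a : FullRankMatrix n m) {ε : ℝ} (hε : 0 < ε) :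
    ∀ᶠ b : Matrix (Fin n) (Fin m) ℝ in 𝓝 a.1,
      ∃ hb : b.rank = m, geodesicEDist a ⟨b, hb⟩ ≤ ENNReal.ofReal ε := by
  have hpt : ∀ t ∈ Icc (0 : ℝ) 1, ∀ᶠ z : Matrix (Fin n) (Fin m) ℝ × ℝ in 𝓝 a.1 ×ˢ 𝓝 t,
      0 < gramRoot (a.1 + z.2 • (z.1 - a.1)) ∧
        matrixMetricNorm (a.1 + z.2 • (z.1 - a.1)) (z.1 - a.1) < ε := by
    intro t _
    have hz : (a.1 + t • (a.1 - a.1)) = a.1 := by simp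
    rw [← nhds_prod_eq]
    have hc : Continuous fun z : Matrix (Fin n) (Fin m) ℝ × ℝ => a.1 + z.2 • (z.1 - a.1) := by
      fun_prop
    have hc' : Continuous fun z : Matrix (Fin n) (Fin m) ℝ × ℝ =>
        (a.1 + z.2 • (z.1 - a.1), z.1 - a.1) := by fun_prop
    refine Filter.Eventually.and ?_ ?_
    · refine (continuous_gramRoot.comp hc).continuousAt.eventually (lt_mem_nhds ?_)
      simpa [hz] using (rank_eq_iff_gramRoot_pos _).mp a.2
    · have h1 : ContinuousAt (fun x : Matrix (Fin n) (Fin m) ℝ × Matrix (Fin n) (Fin m) ℝ =>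
          matrixMetricNorm x.1 x.2) (a.1 + t • (a.1 - a.1), a.1 - a.1) :=
        continuousAt_matrixMetricNorm (by rw [hz]; exact a.2) _
      have h2 := ContinuousAt.comp (x := ((a.1, t) : Matrix (Fin n) (Fin m) ℝ × ℝ))
        (f := fun z : Matrix (Fin n) (Fin m) ℝ × ℝ =>
          (a.1 + z.2 • (z.1 - a.1), z.1 - a.1)) h1 hc'.continuousAt
      refine h2.eventually (gt_mem_nhds ?_)
      simpa [matrixMetricNorm, matrixMetric] using hε
  -- Compactness of [0,1] turns the neighbourhoods found for each t into one valid along the whole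
  -- segment from a to b.
  have hev := (isCompact_Icc : IsCompact (Icc (0 : ℝ) 1)).eventually_forall_of_forall_eventually (x₀ := a.1)
    (P := fun b t => 0 < gramRoot (a.1 + t • (b - a.1)) ∧
      matrixMetricNorm (a.1 + t • (b - a.1)) (b - a.1) < ε)
    (fun t ht => by rw [nhds_prod_eq]; exact hpt t ht)
  filter_upwards [hev] with b hb
  have hb1 : b.rank = m := by
    have := (hb 1 (by simp)).1
    rwa [one_smul, add_sub_cancel, ← rank_eq_iff_gramRoot_pos] at this
  refine ⟨hb1, (geodesicEDist_le_curveLength (isAdmissibleCurve_segment (b := ⟨b, hb1⟩)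
    (add_sub_cancel a.1 b) fun t ht => (rank_eq_iff_gramRoot_pos _).mpr (hb t ht).1)).trans
    (curveLength_le_of_speed_le fun t ht => ?_)⟩
  rw [curveVelocity_segment]
  exact (hb t (Ioo_subset_Icc_self ht)).2.le

end Connectivity

/-! ### Scaling, radial curves and the detour past the added point. -/

section Apex

variable {n m : ℕ}

theorem curveVelocity_smul (γ : ℝ → Matrix (Fin n) (Fin m) ℝ) (r t : ℝ) :
    curveVelocity (fun t => r • γ t) t = r • curveVelocity γ t := by
  ext i j
  exact deriv_const_mul_field r

theorem IsAdmissibleCurve.smul {a b : FullRankMatrix n m} {γ : ℝ → Matrix (Fin n) (Fin m) ℝ}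
    (h : IsAdmissibleCurve a b γ) {r : ℝ} (hr : 0 < r) :
    IsAdmissibleCurve ⟨r • a.1, rank_smul_eq a.2 hr⟩ ⟨r • b.1, rank_smul_eq b.2 hr⟩
      fun t => r • γ t := by
  obtain ⟨S, hS⟩ := h.piecewise_contDiffOn
  exact ⟨h.continuousOn.const_smul r, fun t ht => rank_smul_eq (h.rank_eq t ht) hr,
    ⟨S, fun c d hc hd hcd i j => contDiffOn_const.mul (hS c d hc hd hcd i j)⟩,
    by simp [h.source], by simp [h.target]⟩

theorem IsAdmissibleCurve.curveLength_smul {a b : FullRankMatrix n m}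
    {γ : ℝ → Matrix (Fin n) (Fin m) ℝ} (h : IsAdmissibleCurve a b γ) {r : ℝ} (hr : 0 < r) :
    curveLength (fun t => r • γ t) = ENNReal.ofReal √(r ^ m) * curveLength γ := by
  rw [curveLength, curveLength, ← lintegral_const_mul' _ _ ENNReal.ofReal_ne_top]
  refine setLIntegral_congr_fun measurableSet_Icc fun t ht => ?_
  rw [curveVelocity_smul, matrixMetricNorm_smul_smul (h.rank_eq t ht) _ hr,
    ENNReal.ofReal_mul (Real.sqrt_nonneg _)]

/-- The distance of a matrix to the set of matrices of deficient rank, as measured along the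
radial curve `r ↦ r • a`. -/
def apexDist (a : Matrix (Fin n) (Fin m) ℝ) : ℝ := 2 / √m * gramRoot a

theorem apexDist_nonneg (a : Matrix (Fin n) (Fin m) ℝ) : 0 ≤ apexDist a :=
  mul_nonneg (by positivity) (gramRoot_nonneg a)

theorem continuous_apexDist : Continuous (apexDist : Matrix (Fin n) (Fin m) ℝ → ℝ) :=
  continuous_const.mul continuous_gramRoot

theorem apexDist_eq_zero_of_rank_lt {a : Matrix (Fin n) (Fin m) ℝ} (h : a.rank < m) :
    apexDist a = 0 := by
  rw [apexDist, (rank_lt_iff_gramRoot_eq_zero a).mp h, mul_zero]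

theorem apexDist_pos (hm : 0 < m) {a : Matrix (Fin n) (Fin m) ℝ} (h : a.rank = m) :
    0 < apexDist a :=
  mul_pos (by positivity) ((rank_eq_iff_gramRoot_pos a).mp h)

/-- Since `gramRoot` is homogeneous of degree m/2, the curve y^(2/m)·a with y running linearly from
1 to σ has constant speed (1 - σ)·`apexDist a`. -/
theorem geodesicEDist_smul_le_apexDist (hm : 0 < m) (a : FullRankMatrix n m) {σ : ℝ}
    (h0 : 0 < σ) (h1 : σ < 1) (hr : 0 < σ ^ (2 / m : ℝ)) :
    geodesicEDist a ⟨σ ^ (2 / m : ℝ) • a.1, rank_smul_eq a.2 hr⟩ ≤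
      ENNReal.ofReal (apexDist a.1) := by
  have hm' : (0 : ℝ) < m := Nat.cast_pos.mpr hm
  have hy : ∀ t ∈ Icc (0 : ℝ) 1, 0 < 1 + t * (σ - 1) := fun t ht => by
    nlinarith [ht.1, ht.2]
  have hadm : IsAdmissibleCurve a ⟨σ ^ (2 / m : ℝ) • a.1, rank_smul_eq a.2 hr⟩
      fun t => (1 + t * (σ - 1)) ^ (2 / m : ℝ) • a.1 := by
    refine .of_contDiffOn (fun i j => ?_)
      (fun t ht => rank_smul_eq a.2 (Real.rpow_pos_of_pos (hy t ht) _)) (by simp) (by simp)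
    simp only [Matrix.smul_apply, smul_eq_mul]
    exact ContDiffOn.mul (ContDiffOn.rpow_const_of_ne (by fun_prop) fun t ht => (hy t ht).ne')
      contDiffOn_const
  refine (geodesicEDist_le_curveLength hadm).trans (curveLength_le_of_speed_le fun t ht => ?_)
  have hyt := hy t (Ioo_subset_Icc_self ht)
  set y := 1 + t * (σ - 1) with hydef
  have hr' : 0 < y ^ (2 / m : ℝ) := Real.rpow_pos_of_pos hyt _
  have hd : HasDerivAt (fun t : ℝ => (1 + t * (σ - 1)) ^ (2 / m : ℝ))
      ((σ - 1) * (2 / m) * y ^ ((2 / m : ℝ) - 1)) t := by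
    have h2 : HasDerivAt (fun t : ℝ => 1 + t * (σ - 1)) (σ - 1) t := by
      simpa using ((hasDerivAt_id t).mul_const (σ - 1)).const_add 1
    exact h2.rpow_const (Or.inl hyt.ne')
  have hv : curveVelocity (fun t => (1 + t * (σ - 1)) ^ (2 / m : ℝ) • a.1) t =
      ((σ - 1) * (2 / m) * y ^ ((2 / m : ℝ) - 1)) • a.1 := by
    ext i j
    exact (hd.mul_const (a.1 i j)).deriv
  have hpow : √((y ^ (2 / m : ℝ)) ^ m) = y := by
    rw [← Real.rpow_natCast, ← Real.rpow_mul hyt.le, div_mul_cancel₀ _ hm'.ne',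
      Real.rpow_two, Real.sqrt_sq hyt.le]
  have hq : (σ - 1) * (2 / m) * y ^ ((2 / m : ℝ) - 1) / y ^ (2 / m : ℝ) =
      -((1 - σ) * (2 / m) / y) := by
    rw [Real.rpow_sub hyt, Real.rpow_one]
    field_simp
    ring
  rw [hv, matrixMetricNorm_smul_self a.2 hr', hpow, hq, abs_neg,
    abs_of_nonneg (div_nonneg (mul_nonneg (by linarith) (by positivity)) hyt.le),
    div_mul_cancel₀ _ hyt.ne', apexDist, ← mul_assoc]
  refine mul_le_mul_of_nonneg_right ?_ (gramRoot_nonneg _)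
  have hs : (m : ℝ) = √m * √m := (Real.mul_self_sqrt hm'.le).symm
  have hsp : 0 < √(m : ℝ) := Real.sqrt_pos.mpr hm'
  have h3 : 2 / (m : ℝ) * √m = 2 / √m := by
    rw [div_mul_eq_mul_div, div_eq_div_iff hm'.ne' hsp.ne', mul_assoc, ← hs]
  rw [mul_assoc, h3]
  exact mul_le_of_le_one_left (by positivity) (by linarith)

/-- Shrink a and b radially, join them by a scaled copy of a fixed curve, and let the scale tend to
0. -/
theorem geodesicEDist_le_apexDist_add (hnm : m < n) (a b : FullRankMatrix n m) :
    geodesicEDist a b ≤ ENNReal.ofReal (apexDist a.1 + apexDist b.1) := by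
  rcases m.eq_zero_or_pos with rfl | hm
  · obtain rfl : a = b := Subtype.ext (Subsingleton.elim _ _)
    simp [geodesicEDist_self]
  obtain ⟨γ, hγ, hlt⟩ := exists_curveLength_lt (geodesicEDist_lt_top hnm a b)
  have hm' : (m : ℝ) ≠ 0 := Nat.cast_ne_zero.mpr hm.ne'
  have hle : ∀ᶠ σ : ℝ in 𝓝[>] 0, geodesicEDist a b ≤
      ENNReal.ofReal (apexDist a.1 + apexDist b.1) + ENNReal.ofReal σ * curveLength γ := by
    filter_upwards [Ioo_mem_nhdsGT (zero_lt_one (α := ℝ))] with σ hσ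
    -- The exponent 2/m makes the length of the scaled curve exactly σ times that of γ.
    have hr : 0 < σ ^ (2 / m : ℝ) := Real.rpow_pos_of_pos hσ.1 _
    have hpow : √((σ ^ (2 / m : ℝ)) ^ m) = σ := by
      rw [← Real.rpow_natCast, ← Real.rpow_mul hσ.1.le, div_mul_cancel₀ _ hm',
        Real.rpow_two, Real.sqrt_sq hσ.1.le]
    have h1 := geodesicEDist_smul_le_apexDist hm a hσ.1 hσ.2 hr
    have h2 := geodesicEDist_smul_le_apexDist hm b hσ.1 hσ.2 hr
    have h3 := geodesicEDist_le_curveLength (hγ.smul hr)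
    rw [hγ.curveLength_smul hr, hpow] at h3
    rw [geodesicEDist_comm] at h2
    calc geodesicEDist a b ≤ _ := geodesicEDist_triangle a _ b
      _ ≤ _ := add_le_add h1 ((geodesicEDist_triangle _ _ b).trans (add_le_add h3 h2))
      _ = _ := by rw [ENNReal.ofReal_add (apexDist_nonneg _) (apexDist_nonneg _)]; ring
  have htend : Tendsto (fun σ : ℝ => ENNReal.ofReal (apexDist a.1 + apexDist b.1) +
      ENNReal.ofReal σ * curveLength γ) (𝓝[>] 0)
      (𝓝 (ENNReal.ofReal (apexDist a.1 + apexDist b.1) + ENNReal.ofReal 0 * curveLength γ)) := by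
    refine tendsto_const_nhds.add (ENNReal.Tendsto.mul_const ?_ (Or.inr hlt.ne))
    exact (ENNReal.continuous_ofReal.tendsto 0).mono_left nhdsWithin_le_nhds
  simpa using ge_of_tendsto htend hle

end Apex

/-! ### Lower bounds for the length of curves. -/

section LowerBounds

variable {n m : ℕ}

theorem IsAdmissibleCurve.abs_gramRoot_sub_le {a b : FullRankMatrix n m}
    {γ : ℝ → Matrix (Fin n) (Fin m) ℝ} (h : IsAdmissibleCurve a b γ) {L : ℝ} (hL : 0 ≤ L)
    (hγ : curveLength γ ≤ ENNReal.ofReal L) {s : ℝ} (hs : s ∈ Icc (0 : ℝ) 1) :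
    |gramRoot (γ s) - gramRoot a.1| ≤ √m / 2 * L := by
  obtain ⟨S, hS⟩ := h.exists_hasDerivAt
  rw [← h.source]
  refine abs_sub_le_mul_of_curveLength_le hL (by positivity) hγ S.countable_toSet
    (continuous_gramRoot.comp_continuousOn h.continuousOn)
    (fun t ht => hasDerivAt_gramRoot (hS t ht) (h.rank_eq t (Ioo_subset_Icc_self ht.1)))
    (fun t ht => ?_) hs
  have hr := h.rank_eq t (Ioo_subset_Icc_self ht.1)
  have h1 := Real.abs_le_sqrt (trace_sq_le_gramForm hr (curveVelocity γ t))
  rw [Real.sqrt_mul (Nat.cast_nonneg m)] at h1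
  rw [matrixMetricNorm_eq hr, abs_div, abs_mul, abs_of_nonneg (gramRoot_nonneg _),
    abs_of_pos (two_pos : (0 : ℝ) < 2)]
  have := mul_le_mul_of_nonneg_left h1 (gramRoot_nonneg (γ t))
  linarith

/-- The Riemannian norm dominates the Euclidean one where `gramRoot` is bounded below and the foot
point is bounded. -/
theorem sqrt_frobeniusSq_mul_gramRoot_le {a : Matrix (Fin n) (Fin m) ℝ} (h : a.rank = m)
    (u : Matrix (Fin n) (Fin m) ℝ) :
    √(frobeniusSq u) * gramRoot a ≤ matrixMetricNorm a u * √(frobeniusSq a) := by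
  have h1 := Real.sqrt_le_sqrt (frobeniusSq_le_gramForm_mul h u)
  rw [Real.sqrt_mul (gramForm_nonneg h u)] at h1
  rw [matrixMetricNorm_eq h]
  have := mul_le_mul_of_nonneg_right h1 (gramRoot_nonneg a)
  linarith

/-- Gronwall argument: the logarithm of the squared Frobenius norm has derivative at most 2/c times
the speed. -/
theorem IsAdmissibleCurve.frobeniusSq_le (hm : 0 < m) {a b : FullRankMatrix n m}
    {γ : ℝ → Matrix (Fin n) (Fin m) ℝ} (h : IsAdmissibleCurve a b γ) {L c : ℝ} (hL : 0 ≤ L)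
    (hc : 0 < c) (hγ : curveLength γ ≤ ENNReal.ofReal L)
    (hlow : ∀ t ∈ Icc (0 : ℝ) 1, c ≤ gramRoot (γ t)) {s : ℝ} (hs : s ∈ Icc (0 : ℝ) 1) :
    frobeniusSq (γ s) ≤ frobeniusSq a.1 * Real.exp (2 / c * L) := by
  obtain ⟨S, hS⟩ := h.exists_hasDerivAt
  have hpos : ∀ t ∈ Icc (0 : ℝ) 1, 0 < frobeniusSq (γ t) := fun t ht =>
    frobeniusSq_pos hm (h.rank_eq t ht)
  have hcont : ContinuousOn (fun t => frobeniusSq (γ t)) (Icc 0 1) :=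
    continuousOn_finsetSum _ fun i _ => continuousOn_finsetSum _ fun j _ =>
      (h.continuousOn_apply i j).pow 2
  have hderiv : ∀ t ∈ Ioo (0 : ℝ) 1 \ (S : Set ℝ), HasDerivAt (fun t => frobeniusSq (γ t))
      (2 * ∑ i, ∑ j, γ t i j * curveVelocity γ t i j) t := by
    intro t ht
    simp only [Finset.mul_sum]
    refine HasDerivAt.fun_sum fun i _ => HasDerivAt.fun_sum fun j _ => ?_
    exact ((hS t ht i j).pow 2).congr_deriv (by simp; ring)
  have key := abs_sub_le_mul_of_curveLength_le (φ := fun t => Real.log (frobeniusSq (γ t)))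
    (K := 2 / c) hL (by positivity) hγ S.countable_toSet
    (hcont.log fun t ht => (hpos t ht).ne')
    (fun t ht => (hderiv t ht).log (hpos t (Ioo_subset_Icc_self ht.1)).ne')
    (fun t ht => ?_) hs
  · have h2 := (abs_le.mp key).2
    simp only [h.source] at h2
    have h0 : 0 < frobeniusSq a.1 := frobeniusSq_pos hm a.2
    rw [← Real.exp_log (hpos s hs)]
    calc Real.exp (Real.log (frobeniusSq (γ s)))
        ≤ Real.exp (Real.log (frobeniusSq a.1) + 2 / c * L) := Real.exp_le_exp.mpr (by linarith)
      _ = _ := by rw [Real.exp_add, Real.exp_log h0]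
  · have ht' := Ioo_subset_Icc_self ht.1
    have h3 := abs_sum_mul_le_sqrt_frobeniusSq (γ t) (curveVelocity γ t)
    have h4 := sqrt_frobeniusSq_mul_gramRoot_le (h.rank_eq t ht') (curveVelocity γ t)
    have h5 := hlow t ht'
    have hF := hpos t ht'
    rw [abs_div, abs_mul, abs_of_pos (two_pos : (0 : ℝ) < 2), abs_of_pos hF, div_le_iff₀ hF,
      div_mul_eq_mul_div, div_mul_eq_mul_div, le_div_iff₀ hc]
    have h6 : √(frobeniusSq (curveVelocity γ t)) * c ≤
        matrixMetricNorm (γ t) (curveVelocity γ t) * √(frobeniusSq (γ t)) :=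
      (mul_le_mul_of_nonneg_left h5 (Real.sqrt_nonneg _)).trans h4
    calc 2 * |∑ i, ∑ j, γ t i j * curveVelocity γ t i j| * c
        ≤ 2 * (√(frobeniusSq (γ t)) * √(frobeniusSq (curveVelocity γ t))) * c := by gcongr
      _ = 2 * √(frobeniusSq (γ t)) * (√(frobeniusSq (curveVelocity γ t)) * c) := by ring
      _ ≤ 2 * √(frobeniusSq (γ t)) *
          (matrixMetricNorm (γ t) (curveVelocity γ t) * √(frobeniusSq (γ t))) := by gcongr
      _ = 2 * matrixMetricNorm (γ t) (curveVelocity γ t) *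
          (√(frobeniusSq (γ t)) * √(frobeniusSq (γ t))) := by ring
      _ = _ := by rw [Real.mul_self_sqrt hF.le]

theorem IsAdmissibleCurve.abs_apply_sub_le {a b : FullRankMatrix n m}
    {γ : ℝ → Matrix (Fin n) (Fin m) ℝ} (h : IsAdmissibleCurve a b γ) {L c R : ℝ} (hL : 0 ≤ L)
    (hc : 0 < c) (hγ : curveLength γ ≤ ENNReal.ofReal L)
    (hlow : ∀ t ∈ Icc (0 : ℝ) 1, c ≤ gramRoot (γ t))
    (hR : ∀ t ∈ Icc (0 : ℝ) 1, frobeniusSq (γ t) ≤ R) (i : Fin n) (j : Fin m) :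
    |b.1 i j - a.1 i j| ≤ √R / c * L := by
  obtain ⟨S, hS⟩ := h.exists_hasDerivAt
  have key := abs_sub_le_mul_of_curveLength_le (φ := fun t => γ t i j) (K := √R / c) hL
    (by positivity) hγ S.countable_toSet (h.continuousOn_apply i j)
    (fun t ht => hS t ht i j) (fun t ht => ?_) (right_mem_Icc.mpr zero_le_one)
  · simpa only [h.source, h.target] using key
  · have ht' := Ioo_subset_Icc_self ht.1
    have h4 := sqrt_frobeniusSq_mul_gramRoot_le (h.rank_eq t ht') (curveVelocity γ t)
    have h5 := Real.abs_le_sqrt (sq_apply_le_frobeniusSq (curveVelocity γ t) i j)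
    rw [div_mul_eq_mul_div, le_div_iff₀ hc]
    calc |curveVelocity γ t i j| * c
        ≤ √(frobeniusSq (curveVelocity γ t)) * gramRoot (γ t) := by
          gcongr
          exact hlow t ht'
      _ ≤ matrixMetricNorm (γ t) (curveVelocity γ t) * √(frobeniusSq (γ t)) := h4
      _ ≤ matrixMetricNorm (γ t) (curveVelocity γ t) * √R := by
          have : 0 ≤ matrixMetricNorm (γ t) (curveVelocity γ t) := Real.sqrt_nonneg _
          gcongr
          exact hR t ht'
      _ = _ := mul_comm _ _

theorem abs_gramRoot_sub_le {a b : FullRankMatrix n m} {L : ℝ} (hL : 0 ≤ L)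
    (h : geodesicEDist a b < ENNReal.ofReal L) :
    |gramRoot b.1 - gramRoot a.1| ≤ √m / 2 * L := by
  obtain ⟨γ, hγ, hl⟩ := exists_curveLength_lt h
  have := hγ.abs_gramRoot_sub_le hL hl.le (right_mem_Icc.mpr zero_le_one)
  rwa [hγ.target] at this

/-- Away from the matrices of deficient rank, the geodesic distance controls the Euclidean
distance. -/
theorem bounds_of_geodesicEDist_lt (hm : 0 < m) {a b : FullRankMatrix n m} {L c : ℝ} (hL : 0 ≤ L)
    (hc : 0 < c) (hlow : c + √m / 2 * L ≤ gramRoot a.1)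
    (h : geodesicEDist a b < ENNReal.ofReal L) :
    frobeniusSq b.1 ≤ frobeniusSq a.1 * Real.exp (2 / c * L) ∧
      ∀ i j, |b.1 i j - a.1 i j| ≤ √(frobeniusSq a.1 * Real.exp (2 / c * L)) / c * L := by
  obtain ⟨γ, hγ, hl⟩ := exists_curveLength_lt h
  -- `gramRoot` drops by at most √m/2·L along the curve, the margin reserved in `hlow`.
  have hlow' : ∀ t ∈ Icc (0 : ℝ) 1, c ≤ gramRoot (γ t) := fun t ht => by
    have := (abs_le.mp (hγ.abs_gramRoot_sub_le hL hl.le ht)).1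
    linarith
  have hF := fun (s : ℝ) (hs : s ∈ Icc (0 : ℝ) 1) => hγ.frobeniusSq_le hm hL hc hl.le hlow' hs
  refine ⟨?_, hγ.abs_apply_sub_le hL hc hl.le hlow' hF⟩
  simpa only [hγ.target] using hF 1 (right_mem_Icc.mpr zero_le_one)

end LowerBounds

/-! ### The extended distance and the metric on the quotient. -/

section Completion

variable {n m : ℕ}

open Classical in
/-- The extension of the geodesic distance to all matrices. -/
def completionDist (a b : Matrix (Fin n) (Fin m) ℝ) : ℝ :=
  if h : a.rank = m ∧ b.rank = m then (geodesicEDist ⟨a, h.1⟩ ⟨b, h.2⟩).toReal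
  else apexDist a + apexDist b

theorem completionDist_of_rank_eq {a b : Matrix (Fin n) (Fin m) ℝ} (ha : a.rank = m)
    (hb : b.rank = m) : completionDist a b = (geodesicEDist ⟨a, ha⟩ ⟨b, hb⟩).toReal :=
  dif_pos ⟨ha, hb⟩

theorem completionDist_of_rank_lt_left {a b : Matrix (Fin n) (Fin m) ℝ} (ha : a.rank < m) :
    completionDist a b = apexDist b := by
  rw [completionDist, dif_neg fun h => ha.ne h.1, apexDist_eq_zero_of_rank_lt ha, zero_add]

theorem completionDist_of_rank_lt_right {a b : Matrix (Fin n) (Fin m) ℝ} (hb : b.rank < m) :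
    completionDist a b = apexDist a := by
  rw [completionDist, dif_neg fun h => hb.ne h.2, apexDist_eq_zero_of_rank_lt hb, add_zero]

theorem rank_eq_or_lt (a : Matrix (Fin n) (Fin m) ℝ) : a.rank = m ∨ a.rank < m :=
  a.rank_le_width.eq_or_lt

theorem completionDist_self (a : Matrix (Fin n) (Fin m) ℝ) : completionDist a a = 0 := by
  rcases rank_eq_or_lt a with h | h
  · rw [completionDist_of_rank_eq h h, geodesicEDist_self, ENNReal.toReal_zero]
  · rw [completionDist_of_rank_lt_left h, apexDist_eq_zero_of_rank_lt h]

theorem completionDist_comm (a b : Matrix (Fin n) (Fin m) ℝ) :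
    completionDist a b = completionDist b a := by
  rcases rank_eq_or_lt a with h | h
  · rcases rank_eq_or_lt b with h' | h'
    · rw [completionDist_of_rank_eq h h', completionDist_of_rank_eq h' h, geodesicEDist_comm]
    · rw [completionDist_of_rank_lt_left h', completionDist_of_rank_lt_right h']
  · rw [completionDist_of_rank_lt_left h, completionDist_of_rank_lt_right h]

theorem completionDist_nonneg (a b : Matrix (Fin n) (Fin m) ℝ) : 0 ≤ completionDist a b := by
  rw [completionDist]
  split_ifs
  · exact ENNReal.toReal_nonneg
  · exact add_nonneg (apexDist_nonneg a) (apexDist_nonneg b)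

theorem completionDist_le_apexDist_add (hnm : m < n) (a b : Matrix (Fin n) (Fin m) ℝ) :
    completionDist a b ≤ apexDist a + apexDist b := by
  rw [completionDist]
  split_ifs with h
  · exact ENNReal.toReal_le_of_le_ofReal (add_nonneg (apexDist_nonneg a) (apexDist_nonneg b))
      (geodesicEDist_le_apexDist_add hnm ⟨a, h.1⟩ ⟨b, h.2⟩)
  · exact le_rfl

theorem geodesicEDist_lt_ofReal (hnm : m < n) {a b : Matrix (Fin n) (Fin m) ℝ} (ha : a.rank = m)
    (hb : b.rank = m) {L : ℝ} (h : completionDist a b < L) :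
    geodesicEDist ⟨a, ha⟩ ⟨b, hb⟩ < ENNReal.ofReal L := by
  rw [completionDist_of_rank_eq ha hb] at h
  exact (ENNReal.lt_ofReal_iff_toReal_lt (geodesicEDist_lt_top hnm _ _).ne).mpr h

theorem abs_apexDist_sub_le (hnm : m < n) (a b : Matrix (Fin n) (Fin m) ℝ) :
    |apexDist b - apexDist a| ≤ completionDist a b := by
  rcases rank_eq_or_lt a with ha | ha
  · rcases rank_eq_or_lt b with hb | hb
    · refine le_of_forall_pos_lt_add fun ε hε => ?_
      have hL : 0 ≤ completionDist a b + ε / 2 := by linarith [completionDist_nonneg a b]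
      have h1 := abs_gramRoot_sub_le hL (geodesicEDist_lt_ofReal hnm ha hb
        (lt_add_of_pos_right (completionDist a b) (half_pos hε)))
      have h2 : |apexDist b - apexDist a| = 2 / √m * |gramRoot b - gramRoot a| := by
        rw [apexDist, apexDist, ← mul_sub, abs_mul, abs_of_nonneg (by positivity)]
      -- Only an inequality, because for m = 0 the product is 0 by the convention for division by
      -- zero.
      have h3 : 2 / √m * (√m / 2) ≤ 1 := by
        rw [div_mul_div_comm, mul_comm]; exact div_self_le_one _
      calc |apexDist b - apexDist a| ≤ 2 / √m * (√m / 2 * (completionDist a b + ε / 2)) := by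
            rw [h2]; gcongr
        _ = 2 / √m * (√m / 2) * (completionDist a b + ε / 2) := by ring
        _ ≤ 1 * (completionDist a b + ε / 2) := by gcongr
        _ < completionDist a b + ε := by linarith
    · rw [completionDist_of_rank_lt_right hb, apexDist_eq_zero_of_rank_lt hb, zero_sub, abs_neg,
        abs_of_nonneg (apexDist_nonneg a)]
  · rw [completionDist_of_rank_lt_left ha, apexDist_eq_zero_of_rank_lt ha, sub_zero,
      abs_of_nonneg (apexDist_nonneg b)]

/-- If only the middle point is deficient this is the detour bound; if an end point is deficient it
is the Lipschitz property of `apexDist`. -/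
theorem completionDist_triangle (hnm : m < n) (a b c : Matrix (Fin n) (Fin m) ℝ) :
    completionDist a c ≤ completionDist a b + completionDist b c := by
  have hab := abs_le.mp (abs_apexDist_sub_le hnm a b)
  have hbc := abs_le.mp (abs_apexDist_sub_le hnm b c)
  rcases rank_eq_or_lt a with ha | ha
  · rcases rank_eq_or_lt c with hc | hc
    · rcases rank_eq_or_lt b with hb | hb
      · rw [completionDist_of_rank_eq ha hc, completionDist_of_rank_eq ha hb,
          completionDist_of_rank_eq hb hc, ← ENNReal.toReal_add (geodesicEDist_lt_top hnm _ _).ne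
          (geodesicEDist_lt_top hnm _ _).ne]
        exact ENNReal.toReal_mono (ENNReal.add_lt_top.mpr ⟨geodesicEDist_lt_top hnm _ _,
          geodesicEDist_lt_top hnm _ _⟩).ne (geodesicEDist_triangle _ _ _)
      · rw [completionDist_of_rank_lt_right hb, completionDist_of_rank_lt_left hb]
        exact completionDist_le_apexDist_add hnm a c
    · rw [completionDist_of_rank_lt_right hc, completionDist_of_rank_lt_right hc]
      linarith [hab.1]
  · rw [completionDist_of_rank_lt_left ha, completionDist_of_rank_lt_left ha]
    linarith [hbc.2]

/-- The Euclidean bound holds for every small L > 0 and tends to 0 with L. -/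
theorem eq_of_geodesicEDist_eq_zero {a b : FullRankMatrix n m} (h : geodesicEDist a b = 0) :
    a = b := by
  rcases m.eq_zero_or_pos with rfl | hm
  · exact Subtype.ext (Subsingleton.elim _ _)
  have hg := (rank_eq_iff_gramRoot_pos _).mp a.2
  have hm' : (0 : ℝ) < √m := Real.sqrt_pos.mpr (Nat.cast_pos.mpr hm)
  set c := gramRoot a.1 / 2 with hc
  refine Subtype.ext (Matrix.ext fun i j => ?_)
  have hle : ∀ᶠ L : ℝ in 𝓝[>] 0, |b.1 i j - a.1 i j| ≤
      √(frobeniusSq a.1 * Real.exp (2 / c * L)) / c * L := by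
    -- L < `gramRoot a`/√m ensures √m/2·L < c, so `gramRoot` stays above half its initial value.
    filter_upwards [Ioo_mem_nhdsGT (div_pos hg hm')] with L hL
    refine (bounds_of_geodesicEDist_lt hm hL.1.le (half_pos hg) ?_
      (by rw [h]; exact ENNReal.ofReal_pos.mpr hL.1)).2 i j
    have := (lt_div_iff₀ hm').mp hL.2
    linarith
  have htend : Tendsto (fun L : ℝ => √(frobeniusSq a.1 * Real.exp (2 / c * L)) / c * L) (𝓝[>] 0)
      (𝓝 (√(frobeniusSq a.1 * Real.exp (2 / c * 0)) / c * 0)) :=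
    (Continuous.tendsto (by fun_prop) 0).mono_left nhdsWithin_le_nhds
  have h0 := ge_of_tendsto htend hle
  rw [mul_zero] at h0
  exact (sub_eq_zero.mp (abs_eq_zero.mp (le_antisymm h0 (abs_nonneg _)))).symm

theorem completionDist_eq_zero_iff (hnm : m < n) {a b : Matrix (Fin n) (Fin m) ℝ} :
    completionDist a b = 0 ↔ a = b ∨ (a.rank < m ∧ b.rank < m) := by
  have hlt : ∀ x : Matrix (Fin n) (Fin m) ℝ, 0 < m → apexDist x = 0 → x.rank < m :=
    fun x hm hx => (rank_eq_or_lt x).resolve_left fun h => (apexDist_pos hm h).ne' hx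
  constructor
  · intro h
    rcases rank_eq_or_lt a with ha | ha
    · rcases rank_eq_or_lt b with hb | hb
      · rw [completionDist_of_rank_eq ha hb, ENNReal.toReal_eq_zero_iff] at h
        have h0 := h.resolve_right (geodesicEDist_lt_top hnm _ _).ne
        exact Or.inl (congrArg Subtype.val (eq_of_geodesicEDist_eq_zero h0))
      · rw [completionDist_of_rank_lt_right hb] at h
        exact Or.inr ⟨hlt a (by omega) h, hb⟩
    · rw [completionDist_of_rank_lt_left ha] at h
      exact Or.inr ⟨ha, hlt b (by omega) h⟩
  · rintro (rfl | ⟨ha, hb⟩)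
    · exact completionDist_self a
    · rw [completionDist_of_rank_lt_left ha, apexDist_eq_zero_of_rank_lt hb]

/-- The metric on the quotient `M(n,m)/∼` that extends the geodesic distance. -/
@[reducible] def matrixQuotientMetricSpace (hnm : m < n) : MetricSpace (MatrixQuotient n m) where
  dist := Quotient.lift₂ completionDist fun a b a' b' ha hb => by
    have h1 : completionDist a a' = 0 := (completionDist_eq_zero_iff hnm).mpr ha
    have h2 : completionDist b b' = 0 := (completionDist_eq_zero_iff hnm).mpr hb
    have h1' := completionDist_comm a a'
    have h2' := completionDist_comm b b'
    refine le_antisymm ?_ ?_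
    · linarith [completionDist_triangle hnm a a' b, completionDist_triangle hnm a' b' b]
    · linarith [completionDist_triangle hnm a' a b', completionDist_triangle hnm a b b']
  dist_self := by rintro ⟨a⟩; exact completionDist_self a
  dist_comm := by rintro ⟨a⟩ ⟨b⟩; exact completionDist_comm a b
  dist_triangle := by rintro ⟨a⟩ ⟨b⟩ ⟨c⟩; exact completionDist_triangle hnm a b c
  eq_of_dist_eq_zero := by
    rintro ⟨a⟩ ⟨b⟩ h
    exact Quotient.sound ((completionDist_eq_zero_iff hnm).mp h)

/-! ### Continuity of the projection, density and completeness. -/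

theorem eventually_completionDist_lt (a : Matrix (Fin n) (Fin m) ℝ) {ε : ℝ} (hε : 0 < ε) :
    ∀ᶠ b in 𝓝 a, completionDist b a < ε := by
  rcases rank_eq_or_lt a with ha | ha
  · filter_upwards [eventually_geodesicEDist_le ⟨a, ha⟩ (half_pos hε)] with b hb
    obtain ⟨hb, hd⟩ := hb
    rw [completionDist_comm, completionDist_of_rank_eq ha hb]
    exact (ENNReal.toReal_le_of_le_ofReal (half_pos hε).le hd).trans_lt (half_lt_self hε)
  · have h := (continuous_apexDist.tendsto a).eventually
      (gt_mem_nhds (show apexDist a < ε by rwa [apexDist_eq_zero_of_rank_lt ha]))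
    filter_upwards [h] with b hb
    rwa [completionDist_of_rank_lt_right ha]

theorem continuous_matrixQuotientMk (hnm : m < n) :
    letI := matrixQuotientMetricSpace hnm
    Continuous fun a : Matrix (Fin n) (Fin m) ℝ => matrixQuotientMk a := by
  let _ := matrixQuotientMetricSpace hnm
  exact continuous_iff_continuousAt.mpr fun a => Metric.tendsto_nhds.mpr fun ε hε =>
    eventually_completionDist_lt a hε

theorem exists_rank_eq_width (hnm : m ≤ n) : ∃ a : Matrix (Fin n) (Fin m) ℝ, a.rank = m := by
  refine ⟨Matrix.of fun i j => if i = Fin.castLE hnm j then 1 else 0,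
    rank_eq_width_of_mulVec_ne_zero fun v hv => funext fun j => ?_⟩
  simpa [Matrix.mulVec, dotProduct] using congrFun hv (Fin.castLE hnm j)

/-- The added point is the limit of r·e as r decreases to 0, for any full-rank e. -/
theorem denseRange_matrixQuotientMk (hnm : m < n) :
    letI := matrixQuotientMetricSpace hnm
    DenseRange fun a : FullRankMatrix n m =>
      matrixQuotientMk (a : Matrix (Fin n) (Fin m) ℝ) := by
  let _ := matrixQuotientMetricSpace hnm
  rintro ⟨a⟩
  rcases rank_eq_or_lt a with ha | ha
  · exact subset_closure ⟨⟨a, ha⟩, rfl⟩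
  obtain ⟨e, he⟩ := exists_rank_eq_width hnm.le
  have h0 : matrixQuotientMk a = matrixQuotientMk ((0 : ℝ) • e) := Quotient.sound
    (Or.inr ⟨ha, by rw [zero_smul, Matrix.rank_zero]; omega⟩)
  have htend : Tendsto (fun r : ℝ => matrixQuotientMk (r • e)) (𝓝[>] 0)
      (𝓝 (matrixQuotientMk ((0 : ℝ) • e))) :=
    (((continuous_matrixQuotientMk hnm).comp
      (continuous_id.smul continuous_const)).tendsto (0 : ℝ)).mono_left nhdsWithin_le_nhds
  have hmem := mem_closure_of_tendsto htend (eventually_mem_nhdsWithin.mono fun r hr =>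
    mem_range_self (f := fun a : FullRankMatrix n m =>
      matrixQuotientMk (a : Matrix (Fin n) (Fin m) ℝ)) ⟨r • e, rank_smul_eq he hr⟩)
  rwa [← h0] at hmem

/-- A sequence of matrices that is Cauchy for the extended distance and whose distance to the
matrices of deficient rank is bounded below is Cauchy in every entry. -/
theorem cauchySeq_apply_of_completionDist (hnm : m < n) (hm : 0 < m)
    {u : ℕ → Matrix (Fin n) (Fin m) ℝ} {g : ℝ} (hg : 0 < g)
    (hlow : ∀ᶠ k in atTop, g ≤ gramRoot (u k))
    (hu : ∀ ε > 0, ∃ N, ∀ k ≥ N, ∀ l ≥ N, completionDist (u k) (u l) < ε) (i : Fin n) (j : Fin m) :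
    CauchySeq fun k => u k i j := by
  have hm' : (0 : ℝ) < √m := Real.sqrt_pos.mpr (Nat.cast_pos.mpr hm)
  set c := g / 2 with hc
  -- Chosen so that √m/2·L₀ = c, hence c + √m/2·L ≤ g for all L ≤ L₀.
  set L₀ := g / √m with hL₀
  have hcpos : 0 < c := half_pos hg
  have hL₀pos : 0 < L₀ := div_pos hg hm'
  have hcL : ∀ L ≤ L₀, c + √m / 2 * L ≤ g := fun L hL => by
    have := (le_div_iff₀ hm').mp hL
    linarith
  obtain ⟨N₁, hN₁⟩ := eventually_atTop.mp hlow
  obtain ⟨N₂, hN₂⟩ := hu L₀ hL₀pos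
  set N := max N₁ N₂
  have hrank : ∀ k ≥ N, (u k).rank = m := fun k hk =>
    (rank_eq_iff_gramRoot_pos _).mpr (hg.trans_le (hN₁ k (le_of_max_le_left hk)))
  have hbd : ∀ k (hk : k ≥ N) l (hl : l ≥ N) L, L ≤ L₀ → completionDist (u k) (u l) < L →
      frobeniusSq (u l) ≤ frobeniusSq (u k) * Real.exp (2 / c * L) ∧
      ∀ i j, |u l i j - u k i j| ≤ √(frobeniusSq (u k) * Real.exp (2 / c * L)) / c * L :=
    fun k hk l hl L hL hd => bounds_of_geodesicEDist_lt (a := ⟨u k, hrank k hk⟩)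
      (b := ⟨u l, hrank l hl⟩) hm ((completionDist_nonneg _ _).trans hd.le) hcpos
      ((hcL L hL).trans (hN₁ k (le_of_max_le_left hk)))
      (geodesicEDist_lt_ofReal hnm (hrank k hk) (hrank l hl) hd)
  set R := frobeniusSq (u N) * Real.exp (2 / c * L₀) with hR
  have hFR : ∀ k ≥ N, frobeniusSq (u k) ≤ R := fun k hk =>
    (hbd N le_rfl k hk L₀ le_rfl (hN₂ N (le_max_right _ _) k (le_of_max_le_right hk))).1
  set C := √(R * Real.exp (2 / c * L₀)) / c with hC
  have hC0 : 0 ≤ C := by positivity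
  refine Metric.cauchySeq_iff.mpr fun ε hε => ?_
  set L := min L₀ (ε / (C + 1)) with hL
  have hLpos : 0 < L := lt_min hL₀pos (by positivity)
  obtain ⟨N₃, hN₃⟩ := hu L hLpos
  refine ⟨max N N₃, fun k hk l hl => ?_⟩
  have h1 := (hbd l (le_of_max_le_left hl) k (le_of_max_le_left hk) L (min_le_left _ _)
    (hN₃ l (le_of_max_le_right hl) k (le_of_max_le_right hk))).2 i j
  -- The exponential enters twice: once in R, bounding u l from u N, and once in the step from u l
  -- to u k.
  have h2 : √(frobeniusSq (u l) * Real.exp (2 / c * L)) / c ≤ C := by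
    have := hFR l (le_of_max_le_left hl)
    have := frobeniusSq_nonneg (u l)
    have := min_le_left L₀ (ε / (C + 1))
    have : 0 ≤ R := mul_nonneg (frobeniusSq_nonneg _) (Real.exp_nonneg _)
    rw [hC]
    gcongr
  rw [Real.dist_eq]
  calc |u k i j - u l i j| ≤ C * L := h1.trans (by gcongr)
    _ < (C + 1) * L := by linarith
    _ ≤ (C + 1) * (ε / (C + 1)) := by gcongr; exact min_le_right _ _
    _ = ε := mul_div_cancel₀ _ (by positivity)

theorem completeSpace_matrixQuotient (hnm : m < n) :
    letI := matrixQuotientMetricSpace hnm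
    CompleteSpace (MatrixQuotient n m) := by
  let _ := matrixQuotientMetricSpace hnm
  refine Metric.complete_of_cauchySeq_tendsto fun q hq => ?_
  -- For m = 0 there is a single matrix, of full rank, and no added point.
  rcases m.eq_zero_or_pos with rfl | hm
  · refine ⟨matrixQuotientMk 0, tendsto_const_nhds.congr fun k => ?_⟩
    obtain ⟨a, ha⟩ := Quotient.exists_rep (q k)
    rw [← ha, matrixQuotientMk, Subsingleton.elim a 0]
  choose u hu using fun k => Quotient.exists_rep (q k)
  have hdist : ∀ k l, dist (q k) (q l) = completionDist (u k) (u l) := fun k l => by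
    rw [← hu k, ← hu l]; rfl
  have hcau : ∀ ε > 0, ∃ N, ∀ k ≥ N, ∀ l ≥ N, completionDist (u k) (u l) < ε := by
    simpa only [hdist] using Metric.cauchySeq_iff.mp hq
  have hapex : CauchySeq fun k => apexDist (u k) := by
    refine Metric.cauchySeq_iff.mpr fun ε hε => ?_
    obtain ⟨N, hN⟩ := hcau ε hε
    refine ⟨N, fun k hk l hl => ?_⟩
    rw [Real.dist_eq]
    exact (abs_apexDist_sub_le hnm _ _).trans_lt (hN l hl k hk)
  obtain ⟨r, hr⟩ := cauchySeq_tendsto_of_complete hapex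
  -- Either the sequence runs into the added point, represented by 0, or it eventually stays away
  -- from it and the Euclidean bounds apply.
  rcases (ge_of_tendsto' hr fun k => apexDist_nonneg (u k)).eq_or_lt with rfl | hrpos
  · refine ⟨matrixQuotientMk 0, tendsto_iff_dist_tendsto_zero.mpr (hr.congr fun k => ?_)⟩
    rw [← hu k]
    exact (completionDist_of_rank_lt_right (by rwa [Matrix.rank_zero])).symm
  · have hm' : (0 : ℝ) < √m := Real.sqrt_pos.mpr (Nat.cast_pos.mpr hm)
    have hlow : ∀ᶠ k in atTop, √m / 2 * (r / 2) ≤ gramRoot (u k) := by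
      filter_upwards [hr.eventually (lt_mem_nhds (half_lt_self hrpos))] with k hk
      calc √m / 2 * (r / 2) ≤ √m / 2 * apexDist (u k) := by gcongr
        _ = gramRoot (u k) := by rw [apexDist]; field_simp
    choose A hA using fun i j => cauchySeq_tendsto_of_complete
      (cauchySeq_apply_of_completionDist hnm hm (by positivity) hlow hcau i j)
    have hlim : Tendsto u atTop (𝓝 (Matrix.of A)) :=
      tendsto_pi_nhds.mpr fun i => tendsto_pi_nhds.mpr fun j => hA i j
    exact ⟨matrixQuotientMk (Matrix.of A),
      (((continuous_matrixQuotientMk hnm).tendsto _).comp hlim).congr hu⟩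

end Completion
end

theorem mainTheorem7 (n m : ℕ) (hnm : m < n) :
    ∃ _ : MetricSpace (MatrixQuotient n m),
      IsMetricCompletion (fun a b : FullRankMatrix n m => geodesicEDist a b)
        (fun a : FullRankMatrix n m => matrixQuotientMk (a : Matrix (Fin n) (Fin m) ℝ)) ∧
      Continuous (fun a : Matrix (Fin n) (Fin m) ℝ => matrixQuotientMk a) := by
  let _ := matrixQuotientMetricSpace hnm
  refine ⟨matrixQuotientMetricSpace hnm, ⟨fun a b => ?_, denseRange_matrixQuotientMk hnm,
    completeSpace_matrixQuotient hnm⟩, continuous_matrixQuotientMk hnm⟩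
  have h : dist (matrixQuotientMk a.1) (matrixQuotientMk b.1) = (geodesicEDist a b).toReal :=
    completionDist_of_rank_eq a.2 b.2
  rw [edist_dist, h, ENNReal.ofReal_toReal (geodesicEDist_lt_top hnm a b).ne]
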